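/- **Setting.** Let $d\ge 3$, let $\mathbb S^{d-1}\subset\mathbb R^d$ be the unit sphere with its rotation-invariant surface measure $\omega_{d-1}$ of total mass $1$, and let $e^d=(0,\dots,0,1)^\top$. Let $\mu_d$ be the normalized Haar measure of $SO(d)$. Identify $SO(d-1)$ with the subgroup $\{h\in SO(d): he^d=e^d\}$, and let $\mu_{d-1}$ be its normalized Haar measure. For $n\in\mathbb N_0$ let $\mathcal I_n^d$ be the set of all $k=(k_1,\dots,k_{d-2})\in\mathbb N_0^{d-3}\times\mathbb Z$ with $n\ge k_1\ge\dots\ge k_{d-3}\ge|k_{d-2}|$, and put $k_0=n$. Let $$Y_k^{d,n}=A_k^n\prod_{i=0}^{d-3}C_{k_i-|k_{i+1}|}^{\frac{d-i-2}{2}+|k_{i+1}|}(\cos\theta_{d-i-1})\,\sin^{|k_{i+1}|}(\theta_{d-i-1})\;\mathrm e^{\mathrm i k_{d-2}\theta_1}$$ be the orthonormal spherical harmonics in the spherical coordinates $x_d=\cos\theta_{d-1}$, $x_{d-1}=\sin\theta_{d-1}\cos\theta_{d-2}$, …, $x_2=\sin\theta_{d-1}\cdots\sin\theta_2\cos\theta_1$,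 $x_1=\sin\theta_{d-1}\cdots\sin\theta_2\sin\theta_1$. Here $C_m^\lambda$ are the Gegenbauer polynomials and $A_k^n>0$ is the normalization factor given by $$(A_k^n)^2 = \frac{2^{(d-4)(d-2)}}{\Gamma(\frac d2)} \prod_{i=0}^{d-3}\frac{2^{2|k_{i+1}|-i}\,(k_i-|k_{i+1}|)!\,(2k_i+d-i-2)\,\Gamma(\frac{d-i-2}{2}+|k_{i+1}|)^2}{\sqrt{\pi}\,\Gamma(k_i+|k_{i+1}|+d-i-2)}.$$ Let $\Pi_N(\mathbb S^{d-1})$ be the complex span of all $Y_k^{d,n}$ with $n\le N$, $k\in\mathcal I_n^d$. Let $\Pi_N(SO(d-1))$ be the space of restrictions to $SO(d-1)$ of complex polynomials of total degree at most $N$ in the $(d-1)^2$ matrix entries (for $d=3$: trigonometric polynomials of degree at most $N$ in the rotation angle). Put $$t_{k,m}^{d,n}(g)=\int_{\mathbb S^{d-1}}Y_m^{d,n}(g^{-1}\eta)\,\overline{Y_k^{d,n}(\eta)}\,\mathrm d\omega_{d-1}(\eta),\qquad g\in SO(d),$$ $$\mathcal M_{N,M}^1(SO(d))=\operatorname{span}_{\mathbb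 C}\{t_{k,m}^{d,n}: n\le N,\ k\in\mathcal I_n^d,\ m\in\mathcal I_{\min(n,M)}^d\}.$$ **Lemma 6.** Let $K\in\mathbb N_0$ and $j\in\mathbb N$, $j\geq 1$. Let $\eta_1,\dots,\eta_s\in\mathbb S^{d-1}$ and weights $\omega_1,\dots,\omega_s\ge 0$ satisfy $$\sum_{\ell=1}^{s}\omega_\ell f(\eta_\ell)=\int_{\mathbb S^{d-1}}f\,\mathrm d\omega_{d-1}\qquad\text{for all } f\in\Pi_{2^{j+1}}(\mathbb S^{d-1}),$$ and let $h_1,\dots,h_r\in SO(d-1)$ and weights $\mu_1,\dots,\mu_r>0$ satisfy $$\sum_{m=1}^{r}\mu_m f(h_m)=\int_{SO(d-1)}f\,\mathrm d\mu_{d-1}\qquad\text{for all } f\in\Pi_{2\min(K,2^j)}(SO(d-1)).$$ For each $\ell$ let $g_{\eta_\ell}\in SO(d)$ be an arbitrary rotation with $g_{\eta_\ell}e^d=\eta_\ell$. Then for all $f_1,f_2\in\mathcal M^1_{2^j,K}(SO(d))$ $$\sum_{\ell=1}^{s}\sum_{m=1}^{r}\omega_\ell\,\mu_m\,f_1(g_{\eta_\ell}h_m)\,f_2(g_{\eta_\ell}h_m)=\int_{SO(d)}f_1f_2\,\mathrm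 d\mu_d .$$ -/

import Mathlib

open MeasureTheory

noncomputable section

namespace DirectionalFrames

/-! ### The rotation group and its normalized Haar measure -/

/-- The rotation group `SO(d)`: real orthogonal `d × d` matrices of determinant one. -/
abbrev SO (d : ℕ) : Type := Matrix.specialOrthogonalGroup (Fin d) ℝ

theorem mem_SO_iff {d : ℕ} (A : Matrix (Fin d) (Fin d) ℝ) :
    A ∈ Matrix.specialOrthogonalGroup (Fin d) ℝ ↔ A.transpose * A = 1 ∧ A.det = 1 := by
  rw [Matrix.mem_specialOrthogonalGroup_iff, Matrix.mem_orthogonalGroup_iff']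

theorem coe_inv_SO {d : ℕ} (g : SO d) : ((g⁻¹ : SO d) : Matrix (Fin d) (Fin d) ℝ) =
    (g : Matrix (Fin d) (Fin d) ℝ).transpose := by
  ext i j
  rfl

instance instIsTopologicalGroupSO (d : ℕ) : IsTopologicalGroup (SO d) where
  continuous_inv := by
    refine Continuous.subtype_mk (f := fun g : SO d =>
      (g : Matrix (Fin d) (Fin d) ℝ).transpose) ?_ (fun g => (g⁻¹).2)
    exact continuous_subtype_val.matrix_transpose

theorem isClosed_SO (d : ℕ) :
    IsClosed {A : Matrix (Fin d) (Fin d) ℝ | A ∈ Matrix.specialOrthogonalGroup (Fin d) ℝ} := by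
  have h : {A : Matrix (Fin d) (Fin d) ℝ | A ∈ Matrix.specialOrthogonalGroup (Fin d) ℝ} =
      {A | A.transpose * A = 1} ∩ {A | A.det = 1} := by
    ext A
    exact mem_SO_iff A
  rw [h]
  refine IsClosed.inter ?_ ?_
  · exact isClosed_eq (by fun_prop) continuous_const
  · exact isClosed_eq (by fun_prop) continuous_const

theorem abs_entry_SO_le {d : ℕ} {A : Matrix (Fin d) (Fin d) ℝ}
    (hA : A ∈ Matrix.specialOrthogonalGroup (Fin d) ℝ) (i j : Fin d) : |A i j| ≤ 1 := by
  have h := congrFun (congrFun ((mem_SO_iff A).1 hA).1 j) j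
  rw [Matrix.mul_apply, Matrix.one_apply_eq] at h
  simp only [Matrix.transpose_apply] at h
  have h2 : A i j * A i j ≤ ∑ k, A k j * A k j :=
    Finset.single_le_sum (f := fun k => A k j * A k j) (fun k _ => mul_self_nonneg _)
      (Finset.mem_univ i)
  rw [h] at h2
  exact abs_le_one_iff_mul_self_le_one.2 h2

instance instCompactSpaceSO (d : ℕ) : CompactSpace (SO d) := by
  refine (isCompact_iff_compactSpace (s := {A : Matrix (Fin d) (Fin d) ℝ |
    A ∈ Matrix.specialOrthogonalGroup (Fin d) ℝ})).1 ?_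
  have hc : IsCompact (Set.univ.pi fun _ : Fin d => Set.univ.pi fun _ : Fin d =>
      Set.Icc (-1 : ℝ) 1) :=
    isCompact_univ_pi fun _ => isCompact_univ_pi fun _ => isCompact_Icc
  refine IsCompact.of_isClosed_subset hc (isClosed_SO d) ?_
  intro A hA i _ j _
  exact abs_le.1 (abs_entry_SO_le hA i j)

instance instMeasurableSpaceSO (d : ℕ) : MeasurableSpace (SO d) := borel _

instance instBorelSpaceSO (d : ℕ) : BorelSpace (SO d) := ⟨rfl⟩

/-- The last canonical basis vector `e^d` of `ℝ^d`. -/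
def lastVec (d : ℕ) : Fin d → ℝ := fun i => if (i : ℕ) + 1 = d then 1 else 0

/-- `SO(d-1)`, identified with the subgroup of all `h ∈ SO(d)` with `h e^d = e^d`. -/
def SOsub (d : ℕ) : Subgroup (SO d) where
  carrier := {h | (h : Matrix (Fin d) (Fin d) ℝ).mulVec (lastVec d) = lastVec d}
  one_mem' := by simp
  mul_mem' := by
    intro a b ha hb
    simp only [Set.mem_ofPred_eq, Submonoid.coe_mul] at *
    rw [← Matrix.mulVec_mulVec, hb, ha]
  inv_mem' := by
    intro a ha
    simp only [Set.mem_ofPred_eq] at *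
    conv_lhs => rw [← ha]
    rw [Matrix.mulVec_mulVec, ← Submonoid.coe_mul, inv_mul_cancel, Submonoid.coe_one,
      Matrix.one_mulVec]

instance instCompactSpaceSOsub (d : ℕ) : CompactSpace (SOsub d) := by
  refine (isCompact_iff_compactSpace (s := (SOsub d : Set (SO d)))).1 ?_
  refine IsClosed.isCompact ?_
  have h : (SOsub d : Set (SO d)) =
      {h : SO d | (h : Matrix (Fin d) (Fin d) ℝ).mulVec (lastVec d) = lastVec d} := rfl
  rw [h]
  exact isClosed_eq (continuous_subtype_val.matrix_mulVec continuous_const) continuous_const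

/-- The Haar measure of a compact group, normalized to total mass one. -/
def normalizedHaar (G : Type) [Group G] [TopologicalSpace G] [IsTopologicalGroup G]
    [CompactSpace G] [MeasurableSpace G] [BorelSpace G] : Measure G :=
  Measure.haarMeasure ⊤

/-! ### The sphere and its normalized surface measure -/

/-- The unit sphere `𝕊^{d-1}` of the Euclidean space `ℝ^d`. -/
abbrev Sph (d : ℕ) : Type := Metric.sphere (0 : EuclideanSpace ℝ (Fin d)) 1

/-- The rotation-invariant surface measure on `𝕊^{d-1}`, normalized to total mass one. -/
def sphereMeasure (d : ℕ) : Measure (Sph d) :=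
  ((volume : Measure (EuclideanSpace ℝ (Fin d))).toSphere Set.univ)⁻¹ •
    (volume : Measure (EuclideanSpace ℝ (Fin d))).toSphere

/-- The action of `SO(d)` on the sphere by matrix-vector multiplication. -/
def rotate {d : ℕ} (g : SO d) (x : Sph d) : Sph d :=
  ⟨WithLp.toLp 2 ((g : Matrix (Fin d) (Fin d) ℝ).mulVec x.1.ofLp), by
    have hx : ‖x.1‖ = 1 := by simp
    have hg := ((mem_SO_iff (g : Matrix (Fin d) (Fin d) ℝ)).1 g.2).1
    have hd : ∀ v : EuclideanSpace ℝ (Fin d), ‖v‖ ^ 2 = v.ofLp ⬝ᵥ v.ofLp := by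
      intro v
      rw [EuclideanSpace.real_norm_sq_eq]
      simp [dotProduct, sq]
    have h : ‖WithLp.toLp 2 ((g : Matrix (Fin d) (Fin d) ℝ).mulVec x.1.ofLp)‖ ^ 2 = 1 := by
      rw [hd, Matrix.dotProduct_mulVec, Matrix.vecMul_mulVec, hg, Matrix.vecMul_one, ← hd, hx]
      norm_num
    rw [mem_sphere_zero_iff_norm]
    exact (pow_eq_one_iff_of_nonneg (norm_nonneg _) two_ne_zero).1 h⟩

/-- The representation `T^d(g) f(η) = f(g⁻¹ η)`. -/
def leftRep {d : ℕ} (g : SO d) (f : Sph d → ℂ) : Sph d → ℂ := fun x => f (rotate g⁻¹ x)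

/-! ### Spherical coordinates -/

/-- The coordinate `x_m` (counted from `1`) of a point `x = (x_1, …, x_d)` of the sphere. -/
def coord {d : ℕ} (x : Sph d) (m : ℕ) : ℝ :=
  if h : m - 1 < d then x.1 ⟨m - 1, h⟩ else 0

/-- `√(x_1² + … + x_m²)`. -/
def radius {d : ℕ} (x : Sph d) (m : ℕ) : ℝ :=
  √(∑ i ∈ Finset.Icc 1 m, coord x i ^ 2)

/-- The spherical coordinates `θ_1, …, θ_{d-1}` of a point: `x_2 + i x_1` has argument `θ_1`, and
`θ_m ∈ [0, π]` satisfies `cos θ_m = x_{m+1} / √(x_1² + … + x_{m+1}²)` for `2 ≤ m ≤ d - 1`, so that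
`x_d = cos θ_{d-1}`, `x_{d-1} = sin θ_{d-1} cos θ_{d-2}`, …,
`x_2 = sin θ_{d-1} ⋯ sin θ_2 cos θ_1`, `x_1 = sin θ_{d-1} ⋯ sin θ_2 sin θ_1`.
(Where the coordinates of a point are not unique, the spherical harmonics below take the same
value for all of them.) -/
def angle {d : ℕ} (x : Sph d) (m : ℕ) : ℝ :=
  if m = 1 then Complex.arg (⟨coord x 2, coord x 1⟩ : ℂ)
  else Real.arccos (coord x (m + 1) / radius x (m + 1))

/-! ### Spherical harmonics -/

/-- The Gegenbauer polynomial
`C_m^λ(t) = ∑_{i ≤ m/2} (-1)^i (λ)_{m-i} / (i! (m-2i)!) (2t)^{m-2i}`,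
where `(λ)_k = λ(λ+1)⋯(λ+k-1)`. -/
def gegenbauer (lam : ℝ) (m : ℕ) (t : ℝ) : ℝ :=
  ∑ i ∈ Finset.range (m / 2 + 1),
    (-1) ^ i * (ascPochhammer ℝ (m - i)).eval lam /
      ((i.factorial : ℝ) * ((m - 2 * i).factorial : ℝ)) * (2 * t) ^ (m - 2 * i)

/-- The tuple `(k_0, k_1, …, k_{d-2})` with `k_0 = n` attached to `k = (k_1, …, k_{d-2})`. -/
def extIndex {p : ℕ} (n : ℕ) (k : Fin p → ℤ) : ℕ → ℤ
  | 0 => n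
  | j + 1 => if h : j < p then k ⟨j, h⟩ else 0

/-- The index set `𝓘_n^d` of all `(k_1, …, k_{d-2}) ∈ ℕ₀^{d-3} × ℤ` with
`n ≥ k_1 ≥ … ≥ k_{d-3} ≥ |k_{d-2}|`. -/
def indexSet (d n : ℕ) : Set (Fin (d - 2) → ℤ) :=
  {k | (∀ j, 1 ≤ j → j ≤ d - 3 → 0 ≤ extIndex n k j) ∧
    ∀ j, j ≤ d - 3 → |extIndex n k (j + 1)| ≤ extIndex n k j}

/-- The normalization factor `A_k^n > 0`. -/
def normFactor (d n : ℕ) (k : Fin (d - 2) → ℤ) : ℝ :=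
  √((2 : ℝ) ^ (((d : ℤ) - 4) * ((d : ℤ) - 2)) / Real.Gamma ((d : ℝ) / 2) *
    ∏ j ∈ Finset.range (d - 2),
      ((2 : ℝ) ^ (2 * |extIndex n k (j + 1)| - (j : ℤ)) *
          (((extIndex n k j).natAbs - (extIndex n k (j + 1)).natAbs).factorial : ℝ) *
          (2 * (extIndex n k j : ℝ) + d - j - 2) *
          Real.Gamma (((d : ℝ) - j - 2) / 2 + |(extIndex n k (j + 1) : ℝ)|) ^ 2 /
        (√Real.pi *
          Real.Gamma ((extIndex n k j : ℝ) + |(extIndex n k (j + 1) : ℝ)| + d - j - 2))))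

/-- The spherical harmonic `Y_k^{d,n}` (for `k ∈ 𝓘_n^d`),
`A_k^n ∏_{j=0}^{d-3} C_{k_j - |k_{j+1}|}^{(d-j-2)/2 + |k_{j+1}|}(cos θ_{d-j-1})
  sin^{|k_{j+1}|}(θ_{d-j-1}) · e^{i k_{d-2} θ_1}`. -/
def sphHarmonic (d n : ℕ) (k : Fin (d - 2) → ℤ) (x : Sph d) : ℂ :=
  ((normFactor d n k *
      ∏ j ∈ Finset.range (d - 2),
        (gegenbauer (((d : ℝ) - j - 2) / 2 + |(extIndex n k (j + 1) : ℝ)|)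
            ((extIndex n k j).natAbs - (extIndex n k (j + 1)).natAbs)
            (Real.cos (angle x (d - j - 1))) *
          Real.sin (angle x (d - j - 1)) ^ (extIndex n k (j + 1)).natAbs) : ℝ) : ℂ) *
    Complex.exp (Complex.I * (extIndex n k (d - 2) : ℂ) * (angle x 1 : ℂ))

/-- `Π_N(𝕊^{d-1})`: the span of all `Y_k^{d,n}` with `n ≤ N` and `k ∈ 𝓘_n^d`. -/
def sphPoly (d N : ℕ) : Submodule ℂ (Sph d → ℂ) :=
  Submodule.span ℂ {f | ∃ n ≤ N, ∃ k ∈ indexSet d n, f = sphHarmonic d n k}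

/-! ### Polynomial spaces on the rotation groups -/

/-- The matrix coefficient `t_{k,m}^{d,n}(g) = ⟨T^d(g) Y_m^{d,n}, Y_k^{d,n}⟩`. -/
def matrixCoeff (d n : ℕ) (k m : Fin (d - 2) → ℤ) (g : SO d) : ℂ :=
  ∫ x, leftRep g (sphHarmonic d n m) x * starRingEnd ℂ (sphHarmonic d n k x) ∂(sphereMeasure d)

/-- `𝓜^1_{N,M}(SO(d))`: the span of all `t_{k,m}^{d,n}` with `n ≤ N`, `k ∈ 𝓘_n^d` and
`m ∈ 𝓘_{min(n,M)}^d`. -/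
def classOne (d N M : ℕ) : Submodule ℂ (SO d → ℂ) :=
  Submodule.span ℂ {f | ∃ n ≤ N, ∃ k ∈ indexSet d n, ∃ m ∈ indexSet d (min n M),
    f = matrixCoeff d n k m}

/-- `Π_N(SO(d-1))`: the restrictions to `SO(d-1)` of the complex polynomials of total degree at
most `N` in the `(d-1)²` matrix entries (for `d = 3` these are the trigonometric polynomials of
degree at most `N` in the rotation angle). An element of `SO(d-1) ⊆ SO(d)` is read as a
`(d-1) × (d-1)` matrix through its upper left block. -/
def rotPoly (d N : ℕ) : Set (SOsub d → ℂ) :=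
  {f | ∃ p : MvPolynomial (Fin (d - 1) × Fin (d - 1)) ℂ, p.totalDegree ≤ N ∧
    ∀ h : SOsub d, f h = MvPolynomial.eval (fun ij : Fin (d - 1) × Fin (d - 1) =>
      (((h : SO d) : Matrix (Fin d) (Fin d) ℝ)
        (Fin.castLE (Nat.sub_le d 1) ij.1) (Fin.castLE (Nat.sub_le d 1) ij.2) : ℂ)) p}

end DirectionalFrames

end

noncomputable section

namespace DirectionalFrames

/-! ### Polynomial functions of bounded degree -/

/-! Integrate `F = f₁ f₂` over `SO(d)` in two stages, first over the cosets `g SO(d-1)` and then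
over the sphere; each quadrature rule has to be exact for the integrand of its stage.

Inner stage. A harmonic with index `m` factors as a polynomial in `x_d` times a polynomial of degree
`|m_1|` in the remaining coordinates (`exists_sphHarmonic_eq_mul`). Elements of `SO(d-1)` do not
move `x_d`, so `h ↦ t_{k,m}(g h)` has degree at most `|m_1| ≤ min(n, M)` in the entries of `h`
(`matrixCoeff_mul_mem_polyFun`). On every coset `F` therefore has degree at most `2 min(K, 2^j)`,
and the inner sum equals the average of `F` over the coset, whichever representative is chosen.

Outer stage. This average is right-invariant under `SO(d-1)`, hence of the form `φ(g e^d)`. The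
delicate point is that `φ` is a polynomial on the sphere of degree no larger than that of `F`
(`exists_polyFun_sphere_of_invariant`). It is obtained from a zonal reproducing kernel: let `c(u)`
be the lower right entry of `u` and choose `p` of degree at most `N` with `∫ q(c(u)) p(c(u)) du =
q(1)` for all `q` of degree at most `N`. If `G` is right-invariant of degree at most `N`, then `u ↦
∫ G(g h u) dh` is bi-invariant, thus a polynomial of degree at most `N` in `c(u)`
(`exists_polynomial_cornerEntry`), and the kernel gives `G(g) = ∫ G(u) p(c(g⁻¹ u)) du`. As `c(g⁻¹ u)
= ⟨g e^d, u e^d⟩`, the right side is visibly a polynomial of degree at most `N` in `g e^d`.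

The rule on the sphere is assumed exact only on the span of the explicit harmonics, so these must be
shown to exhaust the polynomials of the given degree (`polyFun_headCoord_le_sphPoly`). This is an
induction on the number of variables, in which the nonzero leading coefficients of the Gegenbauer
polynomials allow powers of the new variable to be solved for. Invariance of the measures and Fubini
finish the proof. -/

/-- The functions on `X` that are polynomials of total degree at most `n` in the functions `v i`. -/
def polyFun {X ι : Type*} (v : ι → X → ℂ) (n : ℕ) : Submodule ℂ (X → ℂ) :=
  (MvPolynomial.restrictTotalDegree ι ℂ n).map (MvPolynomial.aeval v).toLinearMap

/-- A filtration of the algebra of functions on `X` by subspaces, compatible with products. -/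
structure IsFiltration {X : Type*} (S : ℕ → Submodule ℂ (X → ℂ)) : Prop where
  mono : Monotone S
  one : 1 ∈ S 0
  mul : ∀ {m n f g}, f ∈ S m → g ∈ S n → f * g ∈ S (m + n)

theorem isFiltration_span {X : Type*} {G : ℕ → Set (X → ℂ)} (mono : Monotone G) (one : 1 ∈ G 0)
    (mul : ∀ {m n f g}, f ∈ G m → g ∈ G n → f * g ∈ Submodule.span ℂ (G (m + n))) :
    IsFiltration fun n => Submodule.span ℂ (G n) where
  mono _ _ h := Submodule.span_mono (mono h)
  one := Submodule.subset_span one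
  mul {m n f g} hf hg := by
    have h := Submodule.mul_mem_mul hf hg
    rw [Submodule.span_mul_span] at h
    refine Submodule.span_le.2 ?_ h
    rintro _ ⟨f, hf, g, hg, rfl⟩
    exact mul hf hg

namespace IsFiltration

variable {X Z : Type*} {S : ℕ → Submodule ℂ (X → ℂ)}

theorem pow (hS : IsFiltration S) {m : ℕ} {f : X → ℂ} (hf : f ∈ S m) (n : ℕ) :
    f ^ n ∈ S (n * m) := by
  induction n with
  | zero => simpa using hS.one
  | succ n ih => rw [pow_succ, Nat.succ_mul]; exact hS.mul ih hf

theorem prod (hS : IsFiltration S) {ι : Type*} (s : Finset ι) (f : ι → X → ℂ) (e : ι → ℕ)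
    (h : ∀ i ∈ s, f i ∈ S (e i)) : ∏ i ∈ s, f i ∈ S (∑ i ∈ s, e i) := by
  classical
  induction s using Finset.induction_on with
  | empty => simpa using hS.one
  | insert i s hi ih =>
    rw [Finset.prod_insert hi, Finset.sum_insert hi]
    exact hS.mul (h i (by simp)) (ih fun j hj => h j (by simp [hj]))

theorem comap (hS : IsFiltration S) (φ : X → Z) :
    IsFiltration fun n => (S n).comap (LinearMap.funLeft ℂ ℂ φ) where
  mono _ _ h := Submodule.comap_mono (hS.mono h)
  one := hS.one
  mul hf hg := hS.mul hf hg

/-- With the constant filtration, a polynomial of any degree in functions of degree zero still has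
degree zero. This is what makes the factor in `x_d` free of cost. -/
theorem const (hS : IsFiltration S) : IsFiltration fun _ => S 0 where
  mono _ _ _ := le_rfl
  one := hS.one
  mul {_ _ _ _} hf hg := hS.mul (m := 0) (n := 0) hf hg

theorem eval_mem (hS : IsFiltration S) {w : X → ℂ} (hw : w ∈ S 1) {n : ℕ} {p : Polynomial ℂ}
    (hp : p.natDegree ≤ n) : (fun x => p.eval (w x)) ∈ S n := by
  have : (fun x => p.eval (w x)) = ∑ i ∈ Finset.range (p.natDegree + 1), p.coeff i • w ^ i := by
    ext x; simp [Polynomial.eval_eq_sum_range]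
  rw [this]
  refine Submodule.sum_mem _ fun i hi => Submodule.smul_mem _ _ (hS.mono ?_ (hS.pow hw i))
  have := Finset.mem_range.1 hi
  omega

/-- The universal property of `polyFun v`: it is the least filtration having the `v i` in degree
one. Degree bounds are thereby checked on generators only. -/
theorem polyFun_le (hS : IsFiltration S) {ι : Type*} {v : ι → X → ℂ} (hv : ∀ i, v i ∈ S 1)
    (n : ℕ) : polyFun v n ≤ S n := by
  rintro _ ⟨p, hp, rfl⟩
  have hp' := (MvPolynomial.mem_restrictTotalDegree ι n p).1 hp
  simp only [AlgHom.toLinearMap_apply]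
  rw [MvPolynomial.aeval_def, MvPolynomial.eval₂_eq]
  refine Submodule.sum_mem _ fun s hs => ?_
  rw [← Algebra.smul_def]
  refine Submodule.smul_mem _ _ (hS.mono ((MvPolynomial.le_totalDegree hs).trans hp') ?_)
  exact hS.prod _ _ _ fun i _ => by simpa using hS.pow (hv i) (s i)

end IsFiltration

section polyFun

variable {X Z ι : Type*} {v : ι → X → ℂ}

theorem isFiltration_polyFun (v : ι → X → ℂ) : IsFiltration (polyFun v) where
  mono m n h := Submodule.map_mono fun p hp => by
    rw [MvPolynomial.mem_restrictTotalDegree] at hp ⊢; exact hp.trans h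
  one := ⟨1, by simp [MvPolynomial.mem_restrictTotalDegree], by simp⟩
  mul := by
    rintro m n _ _ ⟨p, hp, rfl⟩ ⟨q, hq, rfl⟩
    refine ⟨p * q, ?_, by simp⟩
    simp only [SetLike.mem_coe, MvPolynomial.mem_restrictTotalDegree] at hp hq ⊢
    exact (MvPolynomial.totalDegree_mul _ _).trans (add_le_add hp hq)

theorem var_mem_polyFun (v : ι → X → ℂ) (i : ι) : v i ∈ polyFun v 1 :=
  ⟨MvPolynomial.X i, by simp [MvPolynomial.mem_restrictTotalDegree], by simp⟩

theorem const_mem_polyFun (v : ι → X → ℂ) (c : ℂ) (n : ℕ) : (fun _ => c) ∈ polyFun v n := by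
  have h := (polyFun v n).smul_mem c
    ((isFiltration_polyFun v).mono (Nat.zero_le n) (isFiltration_polyFun v).one)
  convert h using 1
  ext x; simp

theorem comp_mem_of_mem_polyFun {S : ℕ → Submodule ℂ (Z → ℂ)} (hS : IsFiltration S)
    {φ : Z → X} (hv : ∀ i, v i ∘ φ ∈ S 1) {n : ℕ} {f : X → ℂ} (hf : f ∈ polyFun v n) :
    f ∘ φ ∈ S n :=
  (hS.comap φ).polyFun_le hv n hf

theorem mem_polyFun_iff {n : ℕ} {f : X → ℂ} : f ∈ polyFun v n ↔
    ∃ p : MvPolynomial ι ℂ, p.totalDegree ≤ n ∧ ∀ x, f x = p.eval fun i => v i x := by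
  have key : ∀ (p : MvPolynomial ι ℂ) x, MvPolynomial.aeval v p x = p.eval fun i => v i x := by
    intro p x
    rw [MvPolynomial.aeval_def, MvPolynomial.eval₂_eq, MvPolynomial.eval_eq]
    simp [Finset.sum_apply, Finset.prod_apply]
  constructor
  · rintro ⟨p, hp, rfl⟩
    exact ⟨p, (MvPolynomial.mem_restrictTotalDegree ι n p).1 hp, key p⟩
  · rintro ⟨p, hp, h⟩
    exact ⟨p, (MvPolynomial.mem_restrictTotalDegree ι n p).2 hp, funext fun x => by
      rw [h x, ← key p x]; rfl⟩

/-- Continuity phrased as a constant filtration, so that `polyFun_le` also yields continuity of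
polynomial functions. -/
theorem isFiltration_continuous (X : Type*) [TopologicalSpace X] :
    IsFiltration fun _ : ℕ => (⟨⟨⟨{f : X → ℂ | Continuous f}, fun hf hg => hf.add hg⟩,
      continuous_const⟩, fun c _ hf => hf.const_smul c⟩ : Submodule ℂ (X → ℂ)) where
  mono _ _ _ := le_rfl
  one := continuous_const
  mul hf hg := Continuous.mul hf hg

theorem continuous_of_mem_polyFun [TopologicalSpace X] (hv : ∀ i, Continuous (v i)) {n : ℕ}
    {f : X → ℂ} (hf : f ∈ polyFun v n) : Continuous f :=
  (isFiltration_continuous X).polyFun_le hv n hf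

end polyFun

/-! ### Polynomial functions with continuous coefficients -/

/-- The functions on `X × Y` that are combinations of members of `V` with coefficients that are
continuous functions on `Y`. -/
def sepSpan {X : Type*} (V : Submodule ℂ (X → ℂ)) (Y : Type*) [TopologicalSpace Y] :
    Submodule ℂ (X × Y → ℂ) :=
  Submodule.span ℂ {f | ∃ a ∈ V, ∃ b : Y → ℂ, Continuous b ∧ f = fun p => a p.1 * b p.2}

section sepSpan

variable {X Y : Type*} [TopologicalSpace Y]

theorem mul_mem_sepSpan {V : Submodule ℂ (X → ℂ)} {a : X → ℂ} (ha : a ∈ V) {b : Y → ℂ}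
    (hb : Continuous b) : (fun p : X × Y => a p.1 * b p.2) ∈ sepSpan V Y :=
  Submodule.subset_span ⟨a, ha, b, hb, rfl⟩

theorem isFiltration_sepSpan {S : ℕ → Submodule ℂ (X → ℂ)} (hS : IsFiltration S) :
    IsFiltration fun n => sepSpan (S n) Y := by
  refine isFiltration_span (fun m n h => ?_) ?_ ?_
  · rintro _ ⟨a, ha, hb⟩
    exact ⟨a, hS.mono h ha, hb⟩
  · exact ⟨1, hS.one, 1, continuous_const, by ext; simp⟩
  · rintro m n _ _ ⟨a, ha, b, hb, rfl⟩ ⟨a', ha', b', hb', rfl⟩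
    exact Submodule.subset_span ⟨a * a', hS.mul ha ha', b * b', hb.mul hb', by ext; simp; ring⟩

theorem mul_coeff_mem_sepSpan {V : Submodule ℂ (X → ℂ)} {f : X × Y → ℂ} (hf : f ∈ sepSpan V Y)
    {b : Y → ℂ} (hb : Continuous b) : (fun p => f p * b p.2) ∈ sepSpan V Y := by
  induction hf using Submodule.span_induction with
  | mem f h =>
    obtain ⟨a, ha, b', hb', rfl⟩ := h
    simp only [mul_assoc]
    exact mul_mem_sepSpan ha (hb'.mul hb)
  | zero => simp only [Pi.zero_apply, zero_mul]; exact zero_mem _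
  | add f g _ _ h1 h2 => simp only [Pi.add_apply, add_mul]; exact add_mem h1 h2
  | smul c f _ h =>
    simp only [Pi.smul_apply, smul_mul_assoc]; exact Submodule.smul_mem _ c h

variable [CompactSpace Y] [MeasurableSpace Y] [OpensMeasurableSpace Y]

theorem integrable_of_continuous (ν : Measure Y) [IsFiniteMeasure ν] {b : Y → ℂ}
    (hb : Continuous b) : Integrable b ν :=
  hb.integrable_of_hasCompactSupport (HasCompactSupport.of_compactSpace b)

/-- Integrating out `y` replaces each coefficient `b` by a number, so parameter integrals do not
raise the degree. -/
theorem integral_mem_of_mem_sepSpan {V : Submodule ℂ (X → ℂ)} {f : X × Y → ℂ}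
    (hf : f ∈ sepSpan V Y) (ν : Measure Y) [IsFiniteMeasure ν] :
    (fun x => ∫ y, f (x, y) ∂ν) ∈ V := by
  -- Integrability of the slices is carried along because additivity of the integral needs it.
  suffices h : (∀ x, Integrable (fun y => f (x, y)) ν) ∧ (fun x => ∫ y, f (x, y) ∂ν) ∈ V from h.2
  induction hf using Submodule.span_induction with
  | mem f h =>
    obtain ⟨a, ha, b, hb, rfl⟩ := h
    refine ⟨fun x => (integrable_of_continuous ν hb).const_mul (a x), ?_⟩
    simp only [integral_const_mul]
    convert V.smul_mem (∫ y, b y ∂ν) ha using 1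
    ext x; simp [mul_comm]
  | zero =>
    refine ⟨fun x => integrable_zero _ _ _, ?_⟩
    simp only [Pi.zero_apply, integral_zero]
    exact V.zero_mem
  | add f g _ _ h1 h2 =>
    refine ⟨fun x => (h1.1 x).add (h2.1 x), ?_⟩
    convert V.add_mem h1.2 h2.2 using 1
    ext x; exact integral_add (h1.1 x) (h2.1 x)
  | smul c f _ h =>
    refine ⟨fun x => (h.1 x).smul c, ?_⟩
    convert V.smul_mem c h.2 using 1
    ext x; exact integral_smul c _

end sepSpan

/-! ### Spherical harmonics as polynomials -/

/-- `x_1² + … + x_m²`. -/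
def sqRadius {d : ℕ} (x : Sph d) (m : ℕ) : ℝ := ∑ i ∈ Finset.Icc 1 m, coord x i ^ 2

/-- The homogenized Gegenbauer polynomial `ρ^{a/2} C_a^λ(t / √ρ)`. -/
def solidGegenbauer (lam : ℝ) (a : ℕ) (t ρ : ℝ) : ℝ :=
  ∑ i ∈ Finset.range (a / 2 + 1),
    (-1) ^ i * (ascPochhammer ℝ (a - i)).eval lam /
      ((i.factorial : ℝ) * ((a - 2 * i).factorial : ℝ)) * (2 * t) ^ (a - 2 * i) * ρ ^ i

/-- The complex coordinate `x_2 + i x_1`. -/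
def planeCoord {d : ℕ} (x : Sph d) : ℂ := ⟨coord x 2, coord x 1⟩

/-- `|z|^{|κ|} e^{iκθ_1}` for `z = x_2 + i x_1`. -/
def planeHarmonic {d : ℕ} (κ : ℤ) (x : Sph d) : ℂ :=
  if 0 ≤ κ then planeCoord x ^ κ.natAbs else starRingEnd ℂ (planeCoord x) ^ κ.natAbs

/-- The degree of the Gegenbauer factor with index `i`. -/
def stepDegree (κ : ℕ → ℤ) (i : ℕ) : ℕ := (κ i).natAbs - (κ (i + 1)).natAbs

/-- The order of the Gegenbauer factor with index `i`. -/
def stepOrder (d : ℕ) (κ : ℕ → ℤ) (i : ℕ) : ℝ := ((d : ℝ) - i - 2) / 2 + |(κ (i + 1) : ℝ)|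

/-- The unnormalized solid harmonic in the variables `x_1, …, x_{d-j}` with the indices
`κ_j, …, κ_{d-2}`. -/
def solidHarmonic (d : ℕ) (κ : ℕ → ℤ) (j : ℕ) (x : Sph d) : ℂ :=
  ((∏ i ∈ Finset.Ico j (d - 2), solidGegenbauer (stepOrder d κ i) (stepDegree κ i)
    (coord x (d - i)) (sqRadius x (d - i)) : ℝ) : ℂ) * planeHarmonic (κ (d - 2)) x

section coordinates

variable {d : ℕ} (x : Sph d)

theorem sqRadius_nonneg (m : ℕ) : 0 ≤ sqRadius x m :=
  Finset.sum_nonneg fun _ _ => sq_nonneg _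

theorem radius_sq (m : ℕ) : radius x m ^ 2 = sqRadius x m :=
  Real.sq_sqrt (sqRadius_nonneg x m)

theorem sqRadius_succ (m : ℕ) : sqRadius x (m + 1) = sqRadius x m + coord x (m + 1) ^ 2 :=
  Finset.sum_Icc_succ_top (by omega) _

theorem sqRadius_self : sqRadius x d = 1 := by
  have h : ‖x.1‖ = 1 := by simp
  have h2 : ‖x.1‖ ^ 2 = ∑ i, x.1 i ^ 2 := EuclideanSpace.real_norm_sq_eq _
  rw [h, one_pow] at h2
  have h3 : ∑ i : Fin d, x.1 i ^ 2 = ∑ i : Fin d, coord x (i + 1) ^ 2 :=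
    Finset.sum_congr rfl fun i _ => by simp [coord]
  rw [h2, h3, ← Finset.sum_range fun i => coord x (i + 1) ^ 2, Finset.range_eq_Ico,
    Finset.sum_Ico_add' (fun i => coord x i ^ 2) 0 d 1]
  rfl

theorem radius_nonneg (m : ℕ) : 0 ≤ radius x m := Real.sqrt_nonneg _

theorem radius_mul_cos_angle {m : ℕ} (hm : m ≠ 1) :
    radius x (m + 1) * Real.cos (angle x m) = coord x (m + 1) := by
  have h1 := radius_sq x (m + 1)
  have h2 := sqRadius_succ x m
  have h3 := sqRadius_nonneg x m
  have h4 := radius_nonneg x (m + 1)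
  rw [angle, if_neg hm]
  rcases h4.eq_or_lt with h | h
  -- At radius zero the angle comes from the default value of division by zero, but then the
  -- coordinate vanishes as well.
  · rw [← h] at h1 ⊢
    have : coord x (m + 1) = 0 := by
      have : coord x (m + 1) ^ 2 = 0 := by nlinarith [sq_nonneg (coord x (m + 1))]
      simpa using this
    rw [this, zero_mul]
  · have : |coord x (m + 1)| ≤ radius x (m + 1) := abs_le_of_sq_le_sq (by linarith) h4
    have h5 : |coord x (m + 1) / radius x (m + 1)| ≤ 1 := by
      rw [abs_div, abs_of_pos h]; exact div_le_one_of_le₀ this h4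
    rw [Real.cos_arccos (abs_le.1 h5).1 (abs_le.1 h5).2]
    field_simp

/-- Both sides are nonnegative since the angle lies in `[0, π]`, so it suffices to compare squares.
-/
theorem radius_mul_sin_angle {m : ℕ} (hm : m ≠ 1) :
    radius x (m + 1) * Real.sin (angle x m) = radius x m := by
  have hs : 0 ≤ Real.sin (angle x m) := by
    rw [angle, if_neg hm]
    exact Real.sin_nonneg_of_nonneg_of_le_pi (Real.arccos_nonneg _) (Real.arccos_le_pi _)
  refine (pow_left_inj₀ (mul_nonneg (radius_nonneg x _) hs) (radius_nonneg x _) two_ne_zero).1 ?_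
  have h1 := radius_mul_cos_angle x hm
  have h2 := sqRadius_succ x m
  have h3 := radius_sq x (m + 1)
  rw [mul_pow, Real.sin_sq, radius_sq x m]
  rw [← h1, mul_pow] at h2
  linarith

theorem radius_pow_mul_exp_angle (κ : ℤ) :
    ((radius x 2 ^ κ.natAbs : ℝ) : ℂ) * Complex.exp (Complex.I * (κ : ℂ) * (angle x 1 : ℂ)) =
      planeHarmonic κ x := by
  have hr : radius x 2 = ‖planeCoord x‖ := by
    rw [radius, Complex.norm_eq_sqrt_sq_add_sq]
    simp [planeCoord, Finset.sum_Icc_succ_top, add_comm]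
  have ha : angle x 1 = Complex.arg (planeCoord x) := by simp [angle, planeCoord]
  have hz := Complex.norm_mul_exp_arg_mul_I (planeCoord x)
  have hz' : (‖planeCoord x‖ : ℂ) * Complex.exp (-(Complex.arg (planeCoord x) * Complex.I)) =
      starRingEnd ℂ (planeCoord x) := by
    conv_rhs => rw [← hz, map_mul, ← Complex.exp_conj, map_mul]
    simp
  rw [hr, ha, planeHarmonic]
  split_ifs with h
  · conv_rhs => rw [← hz, mul_pow, ← Complex.exp_nat_mul]
    have : (κ : ℂ) = (κ.natAbs : ℂ) := by
      rw [← Int.cast_natCast, Int.natAbs_of_nonneg h]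
    rw [this]
    push_cast
    ring_nf
  · conv_rhs => rw [← hz', mul_pow, ← Complex.exp_nat_mul]
    have : (κ : ℂ) = -(κ.natAbs : ℂ) := by
      rw [← Int.cast_natCast (n := κ.natAbs), Int.ofNat_natAbs_of_nonpos (by omega)]; simp
    rw [this]
    push_cast
    ring_nf

/-- Only the powers `a - 2i` occur in `C_a^λ`, so the surplus factor is `r^{2i}`, a polynomial in
`r²`: no square root survives. -/
theorem pow_mul_gegenbauer (lam : ℝ) (a : ℕ) (r c : ℝ) :
    r ^ a * gegenbauer lam a c = solidGegenbauer lam a (r * c) (r ^ 2) := by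
  rw [gegenbauer, solidGegenbauer, Finset.mul_sum]
  refine Finset.sum_congr rfl fun i hi => ?_
  have : a = (a - 2 * i) + 2 * i := by have := Finset.mem_range.1 hi; omega
  conv_lhs => rw [this, pow_add, pow_mul]
  rw [← this]
  simp only [mul_pow]
  ring

theorem solidHarmonic_eq_solidGegenbauer_mul (κ : ℕ → ℤ) {j : ℕ} (hj : j < d - 2) :
    solidHarmonic d κ j x = (solidGegenbauer (stepOrder d κ j) (stepDegree κ j)
      (coord x (d - j)) (sqRadius x (d - j)) : ℂ) * solidHarmonic d κ (j + 1) x := by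
  rw [solidHarmonic, solidHarmonic, Finset.prod_eq_prod_Ico_succ_bot hj]
  push_cast
  ring

/-- Telescoping: one part of `r_{d-j}^{κ_j}` homogenizes the Gegenbauer factor, and the remaining
`|κ_{j+1}|` powers combine with the sine to give `r_{d-j-1}^{|κ_{j+1}|}` for the next step. -/
theorem radius_pow_mul_prod_eq_solidHarmonic (κ : ℕ → ℤ) {j : ℕ} (hj : j ≤ d - 2) (hd : 2 ≤ d)
    (hκ : ∀ i, j ≤ i → i < d - 2 → |κ (i + 1)| ≤ κ i) :
    ((radius x (d - j) ^ (κ j).natAbs * ∏ i ∈ Finset.Ico j (d - 2),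
      (gegenbauer (stepOrder d κ i) (stepDegree κ i) (Real.cos (angle x (d - i - 1))) *
        Real.sin (angle x (d - i - 1)) ^ (κ (i + 1)).natAbs) : ℝ) : ℂ) *
      Complex.exp (Complex.I * (κ (d - 2) : ℂ) * (angle x 1 : ℂ)) = solidHarmonic d κ j x := by
  induction hj using Nat.decreasingInduction with
  | self =>
    have : d - (d - 2) = 2 := by omega
    rw [this, solidHarmonic, ← radius_pow_mul_exp_angle]
    simp
  | of_succ j hj ih =>
    rw [solidHarmonic_eq_solidGegenbauer_mul x κ hj,
      ← ih fun i hi => hκ i (by omega), Finset.prod_eq_prod_Ico_succ_bot hj]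
    have h1 : d - j = (d - j - 1) + 1 := by omega
    have hm : d - j - 1 ≠ 1 := by omega
    have hdeg : (κ j).natAbs = stepDegree κ j + (κ (j + 1)).natAbs := by
      have := hκ j le_rfl hj
      rw [Int.abs_eq_natAbs] at this
      rw [stepDegree]
      have h2 : (κ (j + 1)).natAbs ≤ (κ j).natAbs := by omega
      omega
    have hc := radius_mul_cos_angle x hm
    have hs := radius_mul_sin_angle x hm
    have hq := radius_sq x (d - j)
    rw [← h1] at hc hs
    have hdj : d - (j + 1) = d - j - 1 := by omega
    rw [← hc, ← hq, ← pow_mul_gegenbauer, hdj, ← hs, hdeg, pow_add, mul_pow]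
    push_cast
    ring

end coordinates

theorem abs_extIndex_succ_le {d n : ℕ} {k : Fin (d - 2) → ℤ} (hk : k ∈ indexSet d n) {i : ℕ}
    (hi : i < d - 2) : |extIndex n k (i + 1)| ≤ extIndex n k i :=
  hk.2 i (by omega)

theorem sphHarmonic_eq {d n : ℕ} (hd : 2 ≤ d) {k : Fin (d - 2) → ℤ} (hk : k ∈ indexSet d n)
    (x : Sph d) :
    sphHarmonic d n k x = (normFactor d n k : ℂ) * solidHarmonic d (extIndex n k) 0 x := by
  rw [← radius_pow_mul_prod_eq_solidHarmonic x (extIndex n k) (Nat.zero_le _) hd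
    fun i _ hi => abs_extIndex_succ_le hk hi, Nat.sub_zero]
  have : radius x d = 1 := by rw [radius, ← sqRadius, sqRadius_self, Real.sqrt_one]
  rw [this, sphHarmonic, Finset.range_eq_Ico]
  simp only [stepOrder, stepDegree, one_pow, one_mul]
  push_cast
  ring

/-- Completeness divides by this factor. All arguments of Gamma are positive because `j ≤ d - 3`. -/
theorem normFactor_pos {d n : ℕ} (hd : 3 ≤ d) {k : Fin (d - 2) → ℤ} (hk : k ∈ indexSet d n) :
    0 < normFactor d n k := by
  have hd' : (0 : ℝ) < d := by positivity
  refine Real.sqrt_pos.2 (mul_pos (div_pos (by positivity) (Real.Gamma_pos_of_pos (by positivity)))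
    (Finset.prod_pos fun j hj => ?_))
  have hj' : (j : ℝ) + 3 ≤ d := by
    have := Finset.mem_range.1 hj
    exact_mod_cast (by omega : j + 3 ≤ d)
  have h1 : (0 : ℝ) ≤ extIndex n k j := by
    exact_mod_cast (abs_nonneg _).trans (abs_extIndex_succ_le hk (Finset.mem_range.1 hj))
  have h2 : (0 : ℝ) ≤ |(extIndex n k (j + 1) : ℝ)| := abs_nonneg _
  have h3 := Real.Gamma_pos_of_pos
    (show 0 < ((d : ℝ) - j - 2) / 2 + |(extIndex n k (j + 1) : ℝ)| by linarith)
  have h4 := Real.Gamma_pos_of_pos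
    (show 0 < (extIndex n k j : ℝ) + |(extIndex n k (j + 1) : ℝ)| + d - j - 2 by linarith)
  have h5 : 0 < 2 * (extIndex n k j : ℝ) + d - j - 2 := by linarith
  positivity

/-! ### Polynomials on the sphere -/

/-- The coordinates `x_1, …, x_m` as functions on the sphere. -/
def headCoord (d m : ℕ) (i : Fin m) (x : Sph d) : ℂ := coord x (i + 1)

section membership

variable {d : ℕ}

theorem coord_mem_polyFun {m i : ℕ} (h1 : 1 ≤ i) (h2 : i ≤ m) :
    (fun x : Sph d => (coord x i : ℂ)) ∈ polyFun (headCoord d m) 1 := by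
  have := var_mem_polyFun (headCoord d m) ⟨i - 1, by omega⟩
  convert this using 1
  ext x
  simp [headCoord, Nat.sub_add_cancel h1]

theorem polyFun_headCoord_mono {m m' : ℕ} (h : m ≤ m') (n : ℕ) :
    polyFun (headCoord d m) n ≤ polyFun (headCoord d m') n :=
  (isFiltration_polyFun _).polyFun_le (fun i => coord_mem_polyFun (by omega) (by omega)) n

theorem sqRadius_mem_polyFun (m : ℕ) :
    (fun x : Sph d => (sqRadius x m : ℂ)) ∈ polyFun (headCoord d m) 2 := by
  have : (fun x : Sph d => (sqRadius x m : ℂ)) =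
      ∑ i ∈ Finset.Icc 1 m, (fun x : Sph d => (coord x i : ℂ)) ^ 2 := by
    ext x; simp [sqRadius]
  rw [this]
  refine Submodule.sum_mem _ fun i hi => ?_
  have hi := Finset.mem_Icc.1 hi
  exact (isFiltration_polyFun _).pow (coord_mem_polyFun hi.1 hi.2) 2

/-- With `t` of weight one and `ρ` of weight two, every term `t^{a-2i} ρ^i` has weight `a`. -/
theorem solidGegenbauer_mem {X : Type*} {S : ℕ → Submodule ℂ (X → ℂ)} (hS : IsFiltration S)
    {t ρ : X → ℝ} (ht : (fun x => (t x : ℂ)) ∈ S 1) (hρ : (fun x => (ρ x : ℂ)) ∈ S 2) (lam : ℝ)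
    (a : ℕ) : (fun x => (solidGegenbauer lam a (t x) (ρ x) : ℂ)) ∈ S a := by
  have : (fun x => (solidGegenbauer lam a (t x) (ρ x) : ℂ)) =
      ∑ i ∈ Finset.range (a / 2 + 1),
        ((((-1) ^ i * (ascPochhammer ℝ (a - i)).eval lam /
          ((i.factorial : ℝ) * ((a - 2 * i).factorial : ℝ)) * 2 ^ (a - 2 * i) : ℝ)) : ℂ) •
        ((fun x => (t x : ℂ)) ^ (a - 2 * i) * (fun x => (ρ x : ℂ)) ^ i) := by
    ext x
    rw [solidGegenbauer, Finset.sum_apply]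
    push_cast
    refine Finset.sum_congr rfl fun i _ => ?_
    simp only [Pi.smul_apply, Pi.mul_apply, Pi.pow_apply, smul_eq_mul, mul_pow]
    ring
  rw [this]
  refine Submodule.sum_mem _ fun i hi => Submodule.smul_mem _ _ ?_
  have := Finset.mem_range.1 hi
  exact hS.mono (by omega) (hS.mul (hS.pow ht (a - 2 * i)) (hS.pow hρ i))

theorem planeHarmonic_mem_polyFun (κ : ℤ) :
    planeHarmonic (d := d) κ ∈ polyFun (headCoord d 2) κ.natAbs := by
  have h1 : (fun x : Sph d => (coord x 1 : ℂ)) ∈ polyFun (headCoord d 2) 1 :=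
    coord_mem_polyFun le_rfl (by omega)
  have h2 : (fun x : Sph d => (coord x 2 : ℂ)) ∈ polyFun (headCoord d 2) 1 :=
    coord_mem_polyFun (by omega) le_rfl
  have hz : planeCoord (d := d) = (fun x : Sph d => (coord x 2 : ℂ)) +
      Complex.I • (fun x : Sph d => (coord x 1 : ℂ)) := by
    ext x; apply Complex.ext <;> simp [planeCoord]
  have hw : (fun x : Sph d => starRingEnd ℂ (planeCoord x)) =
      (fun x : Sph d => (coord x 2 : ℂ)) +
      (-Complex.I) • (fun x : Sph d => (coord x 1 : ℂ)) := by
    ext x; apply Complex.ext <;> simp [planeCoord]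
  by_cases h : 0 ≤ κ
  · have : planeHarmonic (d := d) κ = planeCoord ^ κ.natAbs := by
      ext x; simp [planeHarmonic, h]
    rw [this, hz]
    simpa using (isFiltration_polyFun _).pow (add_mem h2 (Submodule.smul_mem _ _ h1)) κ.natAbs
  · have : planeHarmonic (d := d) κ =
        (fun x : Sph d => starRingEnd ℂ (planeCoord x)) ^ κ.natAbs := by
      ext x; simp [planeHarmonic, h]
    rw [this, hw]
    simpa using
      (isFiltration_polyFun _).pow (add_mem h2 (Submodule.smul_mem _ (-Complex.I) h1)) κ.natAbs

theorem solidHarmonic_top (κ : ℕ → ℤ) :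
    solidHarmonic d κ (d - 2) = planeHarmonic (κ (d - 2)) := by
  ext x; simp [solidHarmonic]

theorem natAbs_le_of_abs_le {a b : ℤ} (h : |a| ≤ b) : a.natAbs ≤ b.natAbs := by
  rw [Int.abs_eq_natAbs] at h; omega

theorem solidHarmonic_mem_polyFun (κ : ℕ → ℤ) {j : ℕ} (hj : j ≤ d - 2) (hd : 2 ≤ d)
    (hκ : ∀ i, j ≤ i → i < d - 2 → |κ (i + 1)| ≤ κ i) :
    solidHarmonic d κ j ∈ polyFun (headCoord d (d - j)) (κ j).natAbs := by
  induction hj using Nat.decreasingInduction with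
  | self =>
    rw [solidHarmonic_top, show d - (d - 2) = 2 by omega]
    exact planeHarmonic_mem_polyFun _
  | of_succ j hj ih =>
    have ih := polyFun_headCoord_mono (show d - (j + 1) ≤ d - j by omega) _
      (ih fun i hi => hκ i (by omega))
    have hdeg : stepDegree κ j + (κ (j + 1)).natAbs = (κ j).natAbs :=
      Nat.sub_add_cancel (natAbs_le_of_abs_le (hκ j le_rfl hj))
    rw [← hdeg]
    convert (isFiltration_polyFun _).mul (solidGegenbauer_mem (isFiltration_polyFun _)
      (coord_mem_polyFun (by omega) le_rfl) (sqRadius_mem_polyFun _)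
      (stepOrder d κ j) (stepDegree κ j)) ih using 1
    ext x
    exact solidHarmonic_eq_solidGegenbauer_mul x κ hj

/-- A spherical harmonic is a polynomial in `x_d` times a polynomial in the other coordinates. -/
theorem exists_sphHarmonic_eq_mul {n : ℕ} (hd : 3 ≤ d) {k : Fin (d - 2) → ℤ}
    (hk : k ∈ indexSet d n) :
    ∃ a ∈ polyFun (fun (_ : Unit) (x : Sph d) => (coord x d : ℂ)) n,
      ∃ q ∈ polyFun (headCoord d (d - 1)) (extIndex n k 1).natAbs,
        sphHarmonic d n k = a * q := by
  -- On the sphere `x_1² + … + x_d² = 1`, so the outermost Gegenbauer factor involves `x_d` alone.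
  refine ⟨_, Submodule.smul_mem _ (normFactor d n k : ℂ)
    ((isFiltration_polyFun _).mono ?_ (solidGegenbauer_mem (isFiltration_polyFun _)
      (t := fun x => coord x d) (ρ := fun _ => 1)
      (var_mem_polyFun (fun (_ : Unit) (x : Sph d) => (coord x d : ℂ)) ())
      (const_mem_polyFun _ _ _) (stepOrder d (extIndex n k) 0) (stepDegree (extIndex n k) 0))),
    _, solidHarmonic_mem_polyFun (extIndex n k) (j := 1) (by omega) (by omega)
      (fun i _ hi => abs_extIndex_succ_le hk hi), ?_⟩
  · exact Nat.sub_le _ _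
  · ext x
    rw [sphHarmonic_eq (by omega) hk, solidHarmonic_eq_solidGegenbauer_mul x _ (by omega)]
    simp only [Nat.sub_zero, sqRadius_self, Pi.mul_apply, Pi.smul_apply, smul_eq_mul, zero_add]
    ring

theorem sphHarmonic_mem_polyFun {n : ℕ} (hd : 3 ≤ d) {k : Fin (d - 2) → ℤ}
    (hk : k ∈ indexSet d n) : sphHarmonic d n k ∈ polyFun (headCoord d d) n := by
  have h := Submodule.smul_mem _ (normFactor d n k : ℂ)
    (solidHarmonic_mem_polyFun (extIndex n k) (j := 0) (by omega) (by omega)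
      (fun i _ hi => abs_extIndex_succ_le hk hi))
  rw [Nat.sub_zero, show (extIndex n k 0).natAbs = n from Int.natAbs_natCast n] at h
  convert h using 1
  ext x
  exact sphHarmonic_eq (by omega) hk x

end membership

/-! ### Completeness of the spherical harmonics -/

/-- The span of the functions `(x_1² + … + x_{d-j}²)^i T` for the solid harmonics `T` in
`x_1, …, x_{d-j}` of degree at most `q - 2i`. -/
def solidSpan (d j q : ℕ) : Submodule ℂ (Sph d → ℂ) :=
  Submodule.span ℂ {f | ∃ (κ : ℕ → ℤ) (i : ℕ),
    (∀ i, j ≤ i → i < d - 2 → |κ (i + 1)| ≤ κ i) ∧ 2 * i + (κ j).natAbs ≤ q ∧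
    f = fun x => (sqRadius x (d - j) : ℂ) ^ i * solidHarmonic d κ j x}

section completeness

variable {d : ℕ}

theorem planeHarmonic_eq_mul_pow (κ : ℤ) (x : Sph d) : planeHarmonic κ x =
    planeCoord x ^ κ.toNat * starRingEnd ℂ (planeCoord x) ^ (-κ).toNat := by
  rw [planeHarmonic]
  split_ifs with h
  · rw [show κ.natAbs = κ.toNat by omega, show (-κ).toNat = 0 by omega, pow_zero, mul_one]
  · rw [show κ.natAbs = (-κ).toNat by omega, show κ.toNat = 0 by omega, pow_zero, one_mul]

/-- Opposite frequencies cancel in pairs through `z z̄ = x_1² + x_2²`, each pair costing degree two.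
-/
theorem planeHarmonic_mul (a b : ℤ) : ∃ e : ℕ, 2 * e + (a + b).natAbs = a.natAbs + b.natAbs ∧
    ∀ x : Sph d, planeHarmonic a x * planeHarmonic b x =
      (sqRadius x 2 : ℂ) ^ e * planeHarmonic (a + b) x := by
  refine ⟨a.toNat + b.toNat - (a + b).toNat, by omega, fun x => ?_⟩
  have hz : (sqRadius x 2 : ℂ) = planeCoord x * starRingEnd ℂ (planeCoord x) := by
    rw [Complex.mul_conj, Complex.normSq_apply]
    simp [sqRadius, planeCoord, Finset.sum_Icc_succ_top]
    ring
  simp only [planeHarmonic_eq_mul_pow]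
  obtain ⟨e, he⟩ : ∃ e, e = a.toNat + b.toNat - (a + b).toNat := ⟨_, rfl⟩
  rw [← he]
  have h1 : a.toNat + b.toNat = e + (a + b).toNat := by omega
  have h2 : (-a).toNat + (-b).toNat = e + (-(a + b)).toNat := by omega
  rw [hz, mul_pow]
  calc _ = planeCoord x ^ (a.toNat + b.toNat) *
        starRingEnd ℂ (planeCoord x) ^ ((-a).toNat + (-b).toNat) := by ring
    _ = _ := by rw [h1, h2]; ring

theorem sqRadius_pow_mul_planeHarmonic_mem (hd : 2 ≤ d) {κ : ℤ} {i q : ℕ}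
    (h : 2 * i + κ.natAbs ≤ q) :
    (fun x : Sph d => (sqRadius x 2 : ℂ) ^ i * planeHarmonic κ x) ∈ solidSpan d (d - 2) q := by
  refine Submodule.subset_span ⟨fun _ => κ, i, fun i h1 h2 => by omega, h, ?_⟩
  rw [solidHarmonic_top, show d - (d - 2) = 2 by omega]

theorem isFiltration_solidSpan_top (hd : 2 ≤ d) : IsFiltration (solidSpan d (d - 2)) := by
  refine isFiltration_span (fun m n h => ?_) ?_ ?_
  · rintro _ ⟨κ, i, h1, h2, h3⟩
    exact ⟨κ, i, h1, h2.trans h, h3⟩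
  · refine ⟨fun _ => 0, 0, fun i h1 h2 => by omega, by simp, ?_⟩
    rw [solidHarmonic_top]
    ext x; simp [planeHarmonic]
  · rintro m n _ _ ⟨κ, i, -, h, rfl⟩ ⟨κ', i', -, h', rfl⟩
    obtain ⟨e, he, hm⟩ := planeHarmonic_mul (d := d) (κ (d - 2)) (κ' (d - 2))
    change _ ∈ solidSpan d (d - 2) (m + n)
    convert sqRadius_pow_mul_planeHarmonic_mem hd (κ := κ (d - 2) + κ' (d - 2))
      (i := i + i' + e) (q := m + n) (by omega) using 1
    ext x
    rw [pow_add, mul_assoc, ← hm x, solidHarmonic_top, solidHarmonic_top,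
      show d - (d - 2) = 2 by omega, Pi.mul_apply]
    ring

theorem polyFun_headCoord_two_le (hd : 2 ≤ d) (q : ℕ) :
    polyFun (headCoord d 2) q ≤ solidSpan d (d - 2) q := by
  refine (isFiltration_solidSpan_top hd).polyFun_le (fun i => ?_) q
  have h1 := sqRadius_pow_mul_planeHarmonic_mem hd (κ := 1) (i := 0) (q := 1) (by simp)
  have h2 := sqRadius_pow_mul_planeHarmonic_mem hd (κ := -1) (i := 0) (q := 1) (by simp)
  fin_cases i
  · convert add_mem (Submodule.smul_mem _ (-Complex.I / 2) h1)
      (Submodule.smul_mem _ (Complex.I / 2) h2) using 1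
    ext x
    apply Complex.ext <;> simp [headCoord, planeHarmonic, planeCoord] <;> ring
  · convert add_mem (Submodule.smul_mem _ (1 / 2 : ℂ) h1)
      (Submodule.smul_mem _ (1 / 2 : ℂ) h2) using 1
    ext x
    apply Complex.ext <;> simp [headCoord, planeHarmonic, planeCoord]
    ring

/-- Bookkeeping for splitting off one variable `t`: total degree is the power of `t` plus the degree
in the others. -/
theorem isFiltration_powSpan {X : Type*} {S : ℕ → Submodule ℂ (X → ℂ)} (hS : IsFiltration S)
    (t : X → ℂ) : IsFiltration fun q => Submodule.span ℂ
      {f | ∃ a b : ℕ, a + b ≤ q ∧ ∃ g ∈ S b, f = t ^ a * g} := by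
  refine isFiltration_span (fun m n h => ?_) ⟨0, 0, by simp, 1, hS.one, by simp⟩ ?_
  · rintro _ ⟨a, b, h1, h2⟩
    exact ⟨a, b, h1.trans h, h2⟩
  · rintro m n _ _ ⟨a, b, h, g, hg, rfl⟩ ⟨a', b', h', g', hg', rfl⟩
    exact Submodule.subset_span ⟨a + a', b + b', by omega, g * g', hS.mul hg hg', by ring⟩

theorem solidGegenbauer_eq_add (lam : ℝ) (a : ℕ) (t ρ : ℝ) : solidGegenbauer lam a t ρ =
    (ascPochhammer ℝ a).eval lam / (a.factorial : ℝ) * 2 ^ a * t ^ a +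
    ∑ i ∈ Finset.range (a / 2), (-1) ^ (i + 1) * (ascPochhammer ℝ (a - (i + 1))).eval lam /
      (((i + 1).factorial : ℝ) * ((a - 2 * (i + 1)).factorial : ℝ)) *
      (2 * t) ^ (a - 2 * (i + 1)) * ρ ^ (i + 1) := by
  rw [solidGegenbauer, Finset.sum_range_succ', add_comm]
  simp [mul_pow]
  ring

/-- The Gegenbauer factor of degree `a` has leading term a nonzero multiple of `x_{d-j}^a`. Solving
for this term leaves lower powers of `x_{d-j}` times powers of the squared radius, which strong
induction on `a` covers. -/
theorem coord_pow_mul_mem_solidSpan {κ : ℕ → ℤ} {j q : ℕ} (hj : j < d - 2)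
    (hκ : ∀ i, j + 1 ≤ i → i < d - 2 → |κ (i + 1)| ≤ κ i) (a l : ℕ)
    (h : a + 2 * l + (κ (j + 1)).natAbs ≤ q) :
    (fun x : Sph d => (coord x (d - j) : ℂ) ^ a * (sqRadius x (d - j) : ℂ) ^ l *
      solidHarmonic d κ (j + 1) x) ∈ solidSpan d j q := by
  induction a using Nat.strong_induction_on generalizing l with
  | _ a ih =>
    -- The entry at `j` is chosen so that the Gegenbauer factor with index `j` has degree exactly
    -- `a`; the tail is untouched.
    set κ' : ℕ → ℤ := Function.update κ j (a + (κ (j + 1)).natAbs : ℕ) with hκ'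
    have hne : ∀ i, j + 1 ≤ i → κ' i = κ i := fun i hi => Function.update_of_ne (by omega) _ _
    have hself : κ' j = (a + (κ (j + 1)).natAbs : ℕ) := Function.update_self ..
    have hvalid : ∀ i, j ≤ i → i < d - 2 → |κ' (i + 1)| ≤ κ' i := by
      intro i hi hi'
      rcases hi.eq_or_lt with rfl | hi
      · rw [hself, hne _ le_rfl, Int.abs_eq_natAbs]; omega
      · rw [hne _ (by omega), hne _ hi]; exact hκ i hi hi'
    have hdeg : stepDegree κ' j = a := by
      rw [stepDegree, hself, hne _ le_rfl, Int.natAbs_natCast]; omega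
    have htail : solidHarmonic d κ' (j + 1) = solidHarmonic d κ (j + 1) := by
      ext x
      rw [solidHarmonic, solidHarmonic, hne _ (by omega)]
      congr 2
      refine Finset.prod_congr rfl fun i hi => ?_
      have := (Finset.mem_Ico.1 hi).1
      rw [stepOrder, stepOrder, stepDegree, stepDegree, hne _ this, hne _ (by omega)]
    -- A positive order makes the Pochhammer symbol in the leading coefficient nonzero.
    have hord : 0 < stepOrder d κ' j := by
      have : (j : ℝ) + 3 ≤ d := by exact_mod_cast (by omega : j + 3 ≤ d)
      have h2 := abs_nonneg ((κ' (j + 1) : ℤ) : ℝ)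
      rw [stepOrder]; linarith
    have hT : (fun x : Sph d => (sqRadius x (d - j) : ℂ) ^ l * solidHarmonic d κ' j x) ∈
        solidSpan d j q :=
      Submodule.subset_span ⟨κ', l, hvalid, by rw [hself]; omega, rfl⟩
    set c : ℝ := (ascPochhammer ℝ a).eval (stepOrder d κ' j) / (a.factorial : ℝ) * 2 ^ a with hc
    have hc0 : (c : ℂ) ≠ 0 := by
      have : 0 < c := by
        have := ascPochhammer_pos a _ hord
        positivity
      exact_mod_cast this.ne'
    have hrest : (fun x : Sph d => ∑ i ∈ Finset.range (a / 2),
        ((((-1) ^ (i + 1) * (ascPochhammer ℝ (a - (i + 1))).eval (stepOrder d κ' j) /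
          (((i + 1).factorial : ℝ) * ((a - 2 * (i + 1)).factorial : ℝ)) *
          2 ^ (a - 2 * (i + 1)) : ℝ)) : ℂ) *
        ((coord x (d - j) : ℂ) ^ (a - 2 * (i + 1)) * (sqRadius x (d - j) : ℂ) ^ (i + 1 + l) *
          solidHarmonic d κ (j + 1) x)) ∈ solidSpan d j q := by
      have := Submodule.sum_mem (solidSpan d j q) (t := Finset.range (a / 2))
        fun i (hi : i ∈ Finset.range (a / 2)) => Submodule.smul_mem _
        ((((-1) ^ (i + 1) * (ascPochhammer ℝ (a - (i + 1))).eval (stepOrder d κ' j) /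
          (((i + 1).factorial : ℝ) * ((a - 2 * (i + 1)).factorial : ℝ)) *
          2 ^ (a - 2 * (i + 1)) : ℝ)) : ℂ)
        (ih (a - 2 * (i + 1)) (by have := Finset.mem_range.1 hi; omega) (i + 1 + l)
          (by have := Finset.mem_range.1 hi; omega))
      convert this using 1
      ext x
      rw [Finset.sum_apply]
      rfl
    convert Submodule.smul_mem _ (c : ℂ)⁻¹ (sub_mem hT hrest) using 1
    ext x
    simp only [Pi.smul_apply, Pi.sub_apply, smul_eq_mul]
    rw [eq_inv_mul_iff_mul_eq₀ hc0, solidHarmonic_eq_solidGegenbauer_mul x κ' hj, htail, hdeg,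
      solidGegenbauer_eq_add, ← hc, eq_sub_iff_add_eq]
    push_cast
    rw [add_mul, mul_add, Finset.sum_mul, Finset.mul_sum]
    congr 1
    · ring
    · refine Finset.sum_congr rfl fun i _ => ?_
      rw [pow_add (sqRadius x (d - j) : ℂ) (i + 1) l, mul_pow]
      ring

/-- The smaller squared radius is eliminated one power at a time by `r_{d-j-1}² = r_{d-j}² -
x_{d-j}²`. -/
theorem coord_pow_mul_sqRadius_pow_mul_mem_solidSpan {κ : ℕ → ℤ} {j q : ℕ} (hj : j < d - 2)
    (hκ : ∀ i, j + 1 ≤ i → i < d - 2 → |κ (i + 1)| ≤ κ i) (i a l : ℕ)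
    (h : a + 2 * i + 2 * l + (κ (j + 1)).natAbs ≤ q) :
    (fun x : Sph d => (coord x (d - j) : ℂ) ^ a * (sqRadius x (d - j) : ℂ) ^ l *
      ((sqRadius x (d - (j + 1)) : ℂ) ^ i * solidHarmonic d κ (j + 1) x)) ∈ solidSpan d j q := by
  induction i generalizing a l with
  | zero =>
    simp only [pow_zero, one_mul]
    exact coord_pow_mul_mem_solidSpan hj hκ a l (by omega)
  | succ i ih =>
    convert sub_mem (ih a (l + 1) (by omega)) (ih (a + 2) l (by omega)) using 1
    ext x
    have hs := sqRadius_succ x (d - (j + 1))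
    rw [show d - (j + 1) + 1 = d - j by omega] at hs
    simp only [Pi.sub_apply, hs]
    push_cast
    ring

/-- Descending induction on `j`: expand in powers of the new variable `x_{d-j}`, apply the
hypothesis to the coefficients, and rewrite the products as solid harmonics in one more variable.
The base case is the plane, with `z` and `z̄` as generators. -/
theorem polyFun_headCoord_le_solidSpan {j : ℕ} (hj : j ≤ d - 2) (hd : 2 ≤ d) (q : ℕ) :
    polyFun (headCoord d (d - j)) q ≤ solidSpan d j q := by
  induction hj using Nat.decreasingInduction generalizing q with
  | self =>
    rw [show d - (d - 2) = 2 by omega]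
    exact polyFun_headCoord_two_le hd q
  | of_succ j hj ih =>
    refine ((isFiltration_powSpan (isFiltration_polyFun (headCoord d (d - (j + 1))))
      fun x => (coord x (d - j) : ℂ)).polyFun_le (fun i => ?_) q).trans ?_
    · by_cases hi : (i : ℕ) + 1 = d - j
      · refine Submodule.subset_span ⟨1, 0, by simp, 1, (isFiltration_polyFun _).one, ?_⟩
        ext x; simp [headCoord, hi]
      · refine Submodule.subset_span ⟨0, 1, by simp, fun x => (coord x (i + 1) : ℂ),
          coord_mem_polyFun (by omega) (by omega), ?_⟩
        ext x; simp [headCoord]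
    · rw [Submodule.span_le]
      rintro _ ⟨a, b, hab, g, hg, rfl⟩
      replace hg := ih b hg
      rw [SetLike.mem_coe]
      induction hg using Submodule.span_induction with
      | mem g h =>
        obtain ⟨κ, i, hκ, h, rfl⟩ := h
        convert coord_pow_mul_sqRadius_pow_mul_mem_solidSpan (q := q) hj hκ i a 0 (by omega) using 1
        ext x; simp
      | zero => rw [mul_zero]; exact zero_mem _
      | add f g _ _ h1 h2 => rw [mul_add]; exact add_mem h1 h2
      | smul c f _ h => rw [mul_smul_comm]; exact Submodule.smul_mem _ c h

/-- Every polynomial of degree at most `N` on the sphere is a combination of spherical harmonics of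
degree at most `N`. -/
theorem polyFun_headCoord_le_sphPoly (hd : 3 ≤ d) (N : ℕ) :
    polyFun (headCoord d d) N ≤ sphPoly d N := by
  refine (polyFun_headCoord_le_solidSpan (Nat.zero_le (d - 2)) (by omega) N).trans ?_
  rw [solidSpan, Submodule.span_le]
  rintro _ ⟨κ, i, hκ, hN, rfl⟩
  set k : Fin (d - 2) → ℤ := fun i => κ (i + 1) with hk
  have h0 : 0 ≤ κ 0 := (abs_nonneg _).trans (hκ 0 le_rfl (by omega))
  have hext : ∀ i, i ≤ d - 2 → extIndex (κ 0).natAbs k i = κ i := by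
    intro i hi
    cases i with
    | zero => rw [extIndex]; omega
    | succ i => rw [extIndex, dif_pos (by omega)]
  have hmem : k ∈ indexSet d (κ 0).natAbs := by
    constructor
    · intro j _ hj
      rw [hext j (by omega)]
      exact (abs_nonneg _).trans (hκ j (by omega) (by omega))
    · intro j hj
      rw [hext j (by omega), hext (j + 1) (by omega)]
      exact hκ j (by omega) (by omega)
  have hA : (normFactor d (κ 0).natAbs k : ℂ) ≠ 0 := by
    exact_mod_cast (normFactor_pos hd hmem).ne'
  have hmem' : sphHarmonic d (κ 0).natAbs k ∈ sphPoly d N :=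
    Submodule.subset_span ⟨_, by omega, k, hmem, rfl⟩
  rw [SetLike.mem_coe]
  convert Submodule.smul_mem _ (normFactor d (κ 0).natAbs k : ℂ)⁻¹ hmem' using 1
  ext x
  have hsolid : solidHarmonic d (extIndex (κ 0).natAbs k) 0 x = solidHarmonic d κ 0 x := by
    rw [solidHarmonic, solidHarmonic, hext _ le_rfl]
    congr 2
    refine Finset.prod_congr rfl fun i hi => ?_
    have := (Finset.mem_Ico.1 hi).2
    rw [stepOrder, stepOrder, stepDegree, stepDegree, hext _ (by omega), hext _ (by omega)]
  rw [Pi.smul_apply, smul_eq_mul, sphHarmonic_eq (by omega) hmem, hsolid, inv_mul_cancel_left₀ hA,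
    Nat.sub_zero, sqRadius_self]
  simp

end completeness

/-! ### Reflections and transitivity -/

/-- The reflection along a nonzero vector `v`. -/
def reflMatrix {d : ℕ} (v : Fin d → ℝ) : Matrix (Fin d) (Fin d) ℝ :=
  1 + Matrix.replicateCol Unit (-(2 / (v ⬝ᵥ v)) • v) * Matrix.replicateRow Unit v

section reflection

variable {d : ℕ}

theorem reflMatrix_apply (v : Fin d → ℝ) (i j : Fin d) : reflMatrix v i j =
    (1 : Matrix (Fin d) (Fin d) ℝ) i j - 2 / (v ⬝ᵥ v) * v i * v j := by
  rw [reflMatrix, Matrix.add_apply, Matrix.mul_apply]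
  simp
  ring

theorem reflMatrix_mulVec (v y : Fin d → ℝ) :
    (reflMatrix v).mulVec y = y - (2 * (v ⬝ᵥ y) / (v ⬝ᵥ v)) • v := by
  ext i
  have h : ∑ j, v i * (2 / (v ⬝ᵥ v)) * (v j * y j) = v i * (2 / (v ⬝ᵥ v)) * (v ⬝ᵥ y) := by
    rw [← Finset.mul_sum]; rfl
  calc (reflMatrix v).mulVec y i
      = ∑ j, ((1 : Matrix (Fin d) (Fin d) ℝ) i j * y j -
          v i * (2 / (v ⬝ᵥ v)) * (v j * y j)) := by
        rw [Matrix.mulVec, dotProduct]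
        exact Finset.sum_congr rfl fun j _ => by rw [reflMatrix_apply]; ring
    _ = y i - v i * (2 / (v ⬝ᵥ v)) * (v ⬝ᵥ y) := by
        rw [Finset.sum_sub_distrib, h]; simp [Matrix.one_apply]
    _ = _ := by simp only [Pi.sub_apply, Pi.smul_apply, smul_eq_mul]; ring

theorem reflMatrix_transpose (v : Fin d → ℝ) : (reflMatrix v).transpose = reflMatrix v := by
  ext i j
  rw [Matrix.transpose_apply, reflMatrix_apply, reflMatrix_apply, Matrix.one_apply,
    Matrix.one_apply]
  simp only [eq_comm (a := i)]
  ring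

theorem reflMatrix_mul_self {v : Fin d → ℝ} (hv : v ⬝ᵥ v ≠ 0) :
    reflMatrix v * reflMatrix v = 1 := by
  refine Matrix.ext_of_mulVec_single fun i => ?_
  rw [← Matrix.mulVec_mulVec, Matrix.one_mulVec]
  generalize (Pi.single i 1 : Fin d → ℝ) = y
  rw [reflMatrix_mulVec, reflMatrix_mulVec, dotProduct_sub, dotProduct_smul]
  ext i
  simp only [Pi.sub_apply, Pi.smul_apply, smul_eq_mul]
  field_simp
  ring

theorem det_reflMatrix {v : Fin d → ℝ} (hv : v ⬝ᵥ v ≠ 0) : (reflMatrix v).det = -1 := by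
  rw [reflMatrix, Matrix.det_one_add_replicateCol_mul_replicateRow, dotProduct_smul, smul_eq_mul]
  field_simp
  norm_num

/-- The reflection along `a - b` exchanges `a` and `b` but has determinant `-1`; a preceding
reflection along `w ⊥ a` corrects the determinant without moving `a`. Vectors orthogonal to both `w`
and `a - b` stay fixed. -/
theorem exists_rotation {a b w : Fin d → ℝ} (ha : a ⬝ᵥ a = 1) (hb : b ⬝ᵥ b = 1) (hw : w ⬝ᵥ w = 1)
    (hwa : w ⬝ᵥ a = 0) : ∃ g : SO d, (g : Matrix (Fin d) (Fin d) ℝ).mulVec a = b ∧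
      ∀ y, w ⬝ᵥ y = 0 → a ⬝ᵥ y = b ⬝ᵥ y → (g : Matrix (Fin d) (Fin d) ℝ).mulVec y = y := by
  by_cases hab : a = b
  · exact ⟨1, by simp [hab], by simp⟩
  have hv : (a - b) ⬝ᵥ (a - b) ≠ 0 := fun h => hab (sub_eq_zero.1 (dotProduct_self_eq_zero.1 h))
  have hw' : w ⬝ᵥ w ≠ 0 := by rw [hw]; exact one_ne_zero
  refine ⟨⟨reflMatrix (a - b) * reflMatrix w, (mem_SO_iff _).2 ⟨?_, ?_⟩⟩, ?_, ?_⟩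
  · rw [Matrix.transpose_mul, reflMatrix_transpose, reflMatrix_transpose, Matrix.mul_assoc,
      ← Matrix.mul_assoc (reflMatrix (a - b)), reflMatrix_mul_self hv, Matrix.one_mul,
      reflMatrix_mul_self hw']
  · rw [Matrix.det_mul, det_reflMatrix hv, det_reflMatrix hw']; norm_num
  · have h : 2 * ((a - b) ⬝ᵥ a) / ((a - b) ⬝ᵥ (a - b)) = 1 := by
      rw [div_eq_one_iff_eq hv]
      simp only [sub_dotProduct, dotProduct_sub, ha, hb, dotProduct_comm b a]
      ring
    simp only
    rw [← Matrix.mulVec_mulVec, reflMatrix_mulVec w, hwa, mul_zero, zero_div, zero_smul, sub_zero,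
      reflMatrix_mulVec, h, one_smul, sub_sub_cancel]
  · intro y hwy hy
    simp only
    rw [← Matrix.mulVec_mulVec, reflMatrix_mulVec w, hwy, mul_zero, zero_div, zero_smul, sub_zero,
      reflMatrix_mulVec, sub_dotProduct, hy, sub_self, mul_zero, zero_div, zero_smul, sub_zero]

/-- The index of the last coordinate. -/
def lastIdx (hd : 3 ≤ d) : Fin d := ⟨d - 1, by omega⟩

/-- The index of the first coordinate. -/
def firstIdx (hd : 3 ≤ d) : Fin d := ⟨0, by omega⟩

/-- The index of the second coordinate. -/
def secondIdx (hd : 3 ≤ d) : Fin d := ⟨1, by omega⟩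

theorem firstIdx_ne_lastIdx (hd : 3 ≤ d) : firstIdx hd ≠ lastIdx hd := by
  simp [firstIdx, lastIdx, Fin.ext_iff]; omega

theorem secondIdx_ne_lastIdx (hd : 3 ≤ d) : secondIdx hd ≠ lastIdx hd := by
  simp [secondIdx, lastIdx, Fin.ext_iff]; omega

theorem firstIdx_ne_secondIdx (hd : 3 ≤ d) : firstIdx hd ≠ secondIdx hd := by
  simp [firstIdx, secondIdx, Fin.ext_iff]

theorem lastVec_eq (hd : 3 ≤ d) : lastVec d = Pi.single (lastIdx hd) 1 := by
  ext i
  rw [lastVec, Pi.single_apply]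
  refine if_congr ?_ rfl rfl
  rw [lastIdx, Fin.ext_iff]
  simp only
  omega

theorem mulVec_lastVec (hd : 3 ≤ d) (A : Matrix (Fin d) (Fin d) ℝ) (i : Fin d) :
    A.mulVec (lastVec d) i = A i (lastIdx hd) := by
  rw [lastVec_eq hd]; simp

theorem lastVec_dotProduct_self (hd : 3 ≤ d) : lastVec d ⬝ᵥ lastVec d = 1 := by
  rw [lastVec_eq hd]; simp

theorem mem_SOsub_iff {h : SO d} :
    h ∈ SOsub d ↔ (h : Matrix (Fin d) (Fin d) ℝ).mulVec (lastVec d) = lastVec d := Iff.rfl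

theorem mulVec_dotProduct_self (g : SO d) (x : Fin d → ℝ) :
    (g : Matrix (Fin d) (Fin d) ℝ).mulVec x ⬝ᵥ (g : Matrix (Fin d) (Fin d) ℝ).mulVec x =
      x ⬝ᵥ x := by
  rw [Matrix.dotProduct_mulVec, Matrix.vecMul_mulVec, ((mem_SO_iff _).1 g.2).1, Matrix.vecMul_one]

/-- `SO(d)` acts transitively on the unit vectors. -/
theorem exists_mulVec_lastVec_eq (hd : 3 ≤ d) {b : Fin d → ℝ} (hb : b ⬝ᵥ b = 1) :
    ∃ g : SO d, (g : Matrix (Fin d) (Fin d) ℝ).mulVec (lastVec d) = b := by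
  obtain ⟨g, hg, -⟩ := exists_rotation (w := Pi.single (firstIdx hd) 1)
    (lastVec_dotProduct_self hd) hb (by simp)
    (by rw [lastVec_eq hd]; simp [firstIdx_ne_lastIdx hd])
  exact ⟨g, hg⟩

/-- Since `d ≥ 3`, the first two coordinates span a plane orthogonal to `e^d`, and orthogonality to
`a` is one linear condition there. -/
theorem exists_unit_orthogonal (hd : 3 ≤ d) (a : Fin d → ℝ) :
    ∃ w : Fin d → ℝ, w ⬝ᵥ w = 1 ∧ w ⬝ᵥ a = 0 ∧ w ⬝ᵥ lastVec d = 0 := by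
  obtain ⟨p, q, hpq, hpq'⟩ : ∃ p q : ℝ, p ^ 2 + q ^ 2 = 1 ∧
      p * a (firstIdx hd) + q * a (secondIdx hd) = 0 := by
    by_cases h : a (firstIdx hd) ^ 2 + a (secondIdx hd) ^ 2 = 0
    · have h0 : a (firstIdx hd) = 0 := by nlinarith [sq_nonneg (a (secondIdx hd))]
      exact ⟨1, 0, by simp, by simp [h0]⟩
    · set s := √(a (firstIdx hd) ^ 2 + a (secondIdx hd) ^ 2)
      have hs : s ^ 2 = a (firstIdx hd) ^ 2 + a (secondIdx hd) ^ 2 := Real.sq_sqrt (by positivity)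
      have hs0 : s ≠ 0 := by rintro h0; rw [h0] at hs; exact h (by linarith)
      refine ⟨-a (secondIdx hd) / s, a (firstIdx hd) / s, ?_, by field_simp; ring⟩
      field_simp
      linarith
  refine ⟨Pi.single (firstIdx hd) p + Pi.single (secondIdx hd) q, ?_, ?_, ?_⟩
  · simp [firstIdx_ne_secondIdx hd, (firstIdx_ne_secondIdx hd).symm]
    linarith
  · simpa using hpq'
  · rw [lastVec_eq hd]
    simp [firstIdx_ne_lastIdx hd, secondIdx_ne_lastIdx hd]

/-- Rotations with the same lower right entry are equivalent under `SO(d-1)`. -/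
theorem exists_mul_mul_eq (hd : 3 ≤ d) {u u' : SO d}
    (h : (u : Matrix (Fin d) (Fin d) ℝ) (lastIdx hd) (lastIdx hd) =
      (u' : Matrix (Fin d) (Fin d) ℝ) (lastIdx hd) (lastIdx hd)) :
    ∃ h₁ h₂ : SOsub d, u' = h₁ * u * h₂ := by
  obtain ⟨w, hw, hwa, hwl⟩ :=
    exists_unit_orthogonal hd ((u : Matrix (Fin d) (Fin d) ℝ).mulVec (lastVec d))
  obtain ⟨g, hg, hg'⟩ := exists_rotation
    (b := (u' : Matrix (Fin d) (Fin d) ℝ).mulVec (lastVec d))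
    ((mulVec_dotProduct_self u _).trans (lastVec_dotProduct_self hd))
    ((mulVec_dotProduct_self u' _).trans (lastVec_dotProduct_self hd)) hw hwa
  -- Equality of the corner entries says that `e^d` is orthogonal to `u e^d - u' e^d`, so the
  -- rotation taking one to the other fixes `e^d`.
  have hgl : g ∈ SOsub d := hg' _ hwl (by
    have hl := mulVec_lastVec hd (u : Matrix (Fin d) (Fin d) ℝ) (lastIdx hd)
    have hl' := mulVec_lastVec hd (u' : Matrix (Fin d) (Fin d) ℝ) (lastIdx hd)
    rw [lastVec_eq hd] at hl hl' ⊢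
    rw [dotProduct_single_one, dotProduct_single_one, hl, hl', h])
  refine ⟨⟨g, hgl⟩, ⟨(g * u)⁻¹ * u', ?_⟩, (mul_inv_cancel_left (g * u) u').symm⟩
  rw [mem_SOsub_iff, Submonoid.coe_mul, ← Matrix.mulVec_mulVec, ← hg,
    Matrix.mulVec_mulVec, Matrix.mulVec_mulVec, ← Submonoid.coe_mul, ← Submonoid.coe_mul,
    mul_assoc, inv_mul_cancel, Submonoid.coe_one, Matrix.one_mulVec]

end reflection

/-! ### Plane rotations -/

section planeRot

variable {d : ℕ}

/-- The embedding of the plane spanned by the first and the last coordinate. -/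
def planeEmb (hd : 3 ≤ d) : Matrix (Fin d) (Fin 2) ℝ :=
  Matrix.of fun i k => (Pi.single (![firstIdx hd, lastIdx hd] k) 1 : Fin d → ℝ) i

theorem planeEmb_transpose_mul (hd : 3 ≤ d) : (planeEmb hd).transpose * planeEmb hd = 1 := by
  ext k l
  change (Pi.single (![firstIdx hd, lastIdx hd] k) 1 : Fin d → ℝ) ⬝ᵥ
    (Pi.single (![firstIdx hd, lastIdx hd] l) 1 : Fin d → ℝ) = _
  rw [single_one_dotProduct]
  fin_cases k <;> fin_cases l <;>
    simp [firstIdx_ne_lastIdx hd, (firstIdx_ne_lastIdx hd).symm]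

/-- The matrix of the rotation of that plane with cosine `c` and sine `s`. -/
def planeRotMatrix (hd : 3 ≤ d) (c s : ℝ) : Matrix (Fin d) (Fin d) ℝ :=
  1 + planeEmb hd * (!![c - 1, -s; s, c - 1] * (planeEmb hd).transpose)

theorem planeRotMatrix_mem (hd : 3 ≤ d) {c s : ℝ} (h : c ^ 2 + s ^ 2 = 1) :
    planeRotMatrix hd c s ∈ Matrix.specialOrthogonalGroup (Fin d) ℝ := by
  have hU := planeEmb_transpose_mul hd
  refine (mem_SO_iff _).2 ⟨?_, ?_⟩
  · rw [planeRotMatrix]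
    generalize planeEmb hd = U at hU ⊢
    set A : Matrix (Fin 2) (Fin 2) ℝ := !![c - 1, -s; s, c - 1] with hA
    -- As the embedding `U` satisfies `UᵀU = 1`, orthogonality of `1 + U A Uᵀ` reduces to this
    -- identity of `2 × 2` matrices.
    have hAA : A + A.transpose + A.transpose * A = 0 := by
      ext i j
      fin_cases i <;> fin_cases j <;> simp [hA, Matrix.mul_apply, Matrix.transpose_apply,
        Fin.sum_univ_two] <;> linarith
    have : (1 + U * (A * U.transpose)).transpose * (1 + U * (A * U.transpose)) =
        1 + U * (A + A.transpose + A.transpose * (U.transpose * U) * A) * U.transpose := by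
      simp only [Matrix.transpose_add, Matrix.transpose_mul, Matrix.transpose_one,
        Matrix.transpose_transpose]
      clear_value A
      simp only [Matrix.mul_add, Matrix.add_mul, Matrix.mul_one, Matrix.one_mul, Matrix.mul_assoc]
      abel
    rw [this, hU, Matrix.mul_one, hAA]
    simp
  · rw [planeRotMatrix, Matrix.det_one_add_mul_comm, Matrix.mul_assoc, hU, Matrix.mul_one,
      Matrix.det_fin_two]
    simp
    linarith

/-- The rotation of the plane of the first and the last coordinate. -/
def planeRot (hd : 3 ≤ d) (t : {t : ℝ × ℝ // t.1 ^ 2 + t.2 ^ 2 = 1}) : SO d :=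
  ⟨planeRotMatrix hd t.1.1 t.1.2, planeRotMatrix_mem hd t.2⟩

theorem planeRotMatrix_apply (hd : 3 ≤ d) (c s : ℝ) (i j : Fin d) : planeRotMatrix hd c s i j =
    (1 : Matrix (Fin d) (Fin d) ℝ) i j + ((c - 1) * (planeEmb hd i 0 * planeEmb hd j 0 +
      planeEmb hd i 1 * planeEmb hd j 1) + s * (planeEmb hd i 1 * planeEmb hd j 0 -
      planeEmb hd i 0 * planeEmb hd j 1)) := by
  rw [planeRotMatrix, Matrix.add_apply, Matrix.mul_apply, Fin.sum_univ_two, Matrix.mul_apply,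
    Matrix.mul_apply, Fin.sum_univ_two, Fin.sum_univ_two]
  simp only [Matrix.transpose_apply, Matrix.of_apply, Matrix.cons_val_zero, Matrix.cons_val_one]
  simp
  ring

theorem planeRotMatrix_last (hd : 3 ≤ d) (c s : ℝ) :
    planeRotMatrix hd c s (lastIdx hd) (lastIdx hd) = c := by
  rw [planeRotMatrix_apply]
  simp [planeEmb, (firstIdx_ne_lastIdx hd).symm]

end planeRot

/-! ### Bi-invariant polynomials -/

/-- The matrix entries as functions on `SO(d)`. -/
def entry (d : ℕ) (ij : Fin d × Fin d) (u : SO d) : ℂ :=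
  ((u : Matrix (Fin d) (Fin d) ℝ) ij.1 ij.2 : ℝ)

/-- The unit circle, as pairs of a cosine and a sine. -/
abbrev CosSin : Type := {t : ℝ × ℝ // t.1 ^ 2 + t.2 ^ 2 = 1}

/-- The monomials `c^i s^e` with `e ≤ 1` and degree at most `n`. -/
def circleMonomials (n : ℕ) : Set (CosSin → ℂ) :=
  {f | ∃ i e : ℕ, i + e ≤ n ∧ e ≤ 1 ∧ f = fun t => (t.1.1 : ℂ) ^ i * (t.1.2 : ℂ) ^ e}

theorem isFiltration_circleMonomials :
    IsFiltration fun n => Submodule.span ℂ (circleMonomials n) := by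
  refine isFiltration_span (fun m n h => ?_) ⟨0, 0, by simp, by simp, by ext; simp⟩ ?_
  · rintro _ ⟨i, e, h1, h2, h3⟩
    exact ⟨i, e, h1.trans h, h2, h3⟩
  · rintro m n _ _ ⟨i, e, h1, h2, rfl⟩ ⟨i', e', h1', h2', rfl⟩
    by_cases he : e + e' ≤ 1
    · refine Submodule.subset_span ⟨i + i', e + e', by omega, he, ?_⟩
      ext t
      simp only [Pi.mul_apply]
      ring
    · obtain rfl : e = 1 := by omega
      obtain rfl : e' = 1 := by omega
      -- The product contains `s²`, which is replaced by `1 - c²` at the same degree.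
      convert (Submodule.span ℂ (circleMonomials (m + n))).sub_mem
        (Submodule.subset_span ⟨i + i', 0, by omega, by omega, rfl⟩)
        (Submodule.subset_span ⟨i + i' + 2, 0, by omega, by omega, rfl⟩) using 1
      ext t
      have ht : (t.1.1 : ℂ) ^ 2 + (t.1.2 : ℂ) ^ 2 = 1 := by exact_mod_cast t.2
      simp only [Pi.mul_apply, Pi.sub_apply]
      linear_combination (t.1.1 : ℂ) ^ (i + i') * ht

/-- Adding the values at `s` and `-s` removes the terms odd in `s`; what remains depends on `c`
only. -/
theorem exists_polynomial_of_mem_circleMonomials {n : ℕ} {f : CosSin → ℂ}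
    (hf : f ∈ Submodule.span ℂ (circleMonomials n)) :
    ∃ q : Polynomial ℂ, q.natDegree ≤ n ∧ ∀ t t' : CosSin, t.1.1 = t'.1.1 → t.1.2 = -t'.1.2 →
      f t + f t' = q.eval (t.1.1 : ℂ) := by
  induction hf using Submodule.span_induction with
  | mem f h =>
    obtain ⟨i, e, h1, h2, rfl⟩ := h
    interval_cases e
    · refine ⟨Polynomial.C 2 * Polynomial.X ^ i,
        (Polynomial.natDegree_C_mul_X_pow_le _ _).trans h1, fun t t' h h' => ?_⟩
      simp [h]
      ring
    · exact ⟨0, by simp, fun t t' h h' => by simp [h, h']⟩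
  | zero => exact ⟨0, by simp, by simp⟩
  | add f g _ _ hf hg =>
    obtain ⟨p, hp, hp'⟩ := hf
    obtain ⟨q, hq, hq'⟩ := hg
    refine ⟨p + q, (Polynomial.natDegree_add_le _ _).trans (max_le hp hq), fun t t' h h' => ?_⟩
    rw [Polynomial.eval_add, ← hp' t t' h h', ← hq' t t' h h']
    simp only [Pi.add_apply]
    ring
  | smul c f _ hf =>
    obtain ⟨p, hp, hp'⟩ := hf
    refine ⟨c • p, (Polynomial.natDegree_smul_le _ _).trans hp, fun t t' h h' => ?_⟩
    rw [Polynomial.eval_smul, ← hp' t t' h h']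
    simp only [Pi.smul_apply, smul_eq_mul]
    ring

section biinvariant

variable {d : ℕ}

theorem entry_planeRot_mem (hd : 3 ≤ d) (ij : Fin d × Fin d) :
    entry d ij ∘ planeRot hd ∈ Submodule.span ℂ (circleMonomials 1) := by
  have h1 : (fun _ => 1 : CosSin → ℂ) ∈ Submodule.span ℂ (circleMonomials 1) :=
    Submodule.subset_span ⟨0, 0, by simp, by simp, by simp⟩
  have hc : (fun t => t.1.1 : CosSin → ℂ) ∈ Submodule.span ℂ (circleMonomials 1) :=
    Submodule.subset_span ⟨1, 0, by simp, by simp, by simp⟩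
  have hs : (fun t => t.1.2 : CosSin → ℂ) ∈ Submodule.span ℂ (circleMonomials 1) :=
    Submodule.subset_span ⟨0, 1, by simp, by simp, by simp⟩
  have := add_mem (Submodule.smul_mem _
    (((1 : Matrix (Fin d) (Fin d) ℝ) ij.1 ij.2 : ℝ) : ℂ) h1) (add_mem
    (Submodule.smul_mem _ (((planeEmb hd ij.1 0 * planeEmb hd ij.2 0 +
      planeEmb hd ij.1 1 * planeEmb hd ij.2 1 : ℝ)) : ℂ) (sub_mem hc h1))
    (Submodule.smul_mem _ (((planeEmb hd ij.1 1 * planeEmb hd ij.2 0 -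
      planeEmb hd ij.1 0 * planeEmb hd ij.2 1 : ℝ)) : ℂ) hs))
  convert this using 1
  ext t
  simp only [Function.comp_apply, entry, planeRot, planeRotMatrix_apply, Pi.add_apply,
    Pi.smul_apply, Pi.sub_apply, smul_eq_mul]
  push_cast
  ring

/-- The lower right entry of a rotation. -/
def cornerEntry (hd : 3 ≤ d) (u : SO d) : ℝ :=
  (u : Matrix (Fin d) (Fin d) ℝ) (lastIdx hd) (lastIdx hd)

theorem cornerEntry_planeRot (hd : 3 ≤ d) (t : CosSin) : cornerEntry hd (planeRot hd t) = t.1.1 :=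
  planeRotMatrix_last hd _ _

theorem exists_cosSin {c : ℝ} (hc : |c| ≤ 1) : ∃ t t' : CosSin, t.1.1 = c ∧ t'.1.1 = c ∧
    t.1.2 = -t'.1.2 := by
  have h : √(1 - c ^ 2) ^ 2 = 1 - c ^ 2 :=
    Real.sq_sqrt (by have := (sq_le_one_iff_abs_le_one c).2 hc; linarith)
  exact ⟨⟨(c, -√(1 - c ^ 2)), by simp [h]⟩, ⟨(c, √(1 - c ^ 2)), by simp [h]⟩, rfl, rfl, rfl⟩

/-- A polynomial on `SO(d)` that is invariant under `SO(d-1)` from both sides is a polynomial in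
the lower right entry. -/
theorem exists_polynomial_cornerEntry (hd : 3 ≤ d) {N : ℕ} {f : SO d → ℂ}
    (hf : f ∈ polyFun (entry d) N) (hl : ∀ (h : SOsub d) u, f (h * u) = f u)
    (hr : ∀ (h : SOsub d) u, f (u * h) = f u) :
    ∃ q : Polynomial ℂ, q.natDegree ≤ N ∧ ∀ u, f u = q.eval (cornerEntry hd u : ℂ) := by
  have hu : ∀ u u', cornerEntry hd u = cornerEntry hd u' → f u = f u' := by
    intro u u' h
    obtain ⟨h₁, h₂, rfl⟩ := exists_mul_mul_eq hd h
    rw [hr, hl]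
  obtain ⟨q, hq, hq'⟩ := exists_polynomial_of_mem_circleMonomials
    (comp_mem_of_mem_polyFun isFiltration_circleMonomials (entry_planeRot_mem hd) hf)
  refine ⟨Polynomial.C (1 / 2) * q, (Polynomial.natDegree_C_mul_le _ _).trans hq, fun u => ?_⟩
  -- The plane rotations with cosine `c(u)` and sines `±s` all share the corner entry of `u`, so `f`
  -- takes the value `f u` at both and their sum is `2 f u`.
  obtain ⟨t, t', ht, ht', hs⟩ := exists_cosSin (abs_entry_SO_le u.2 (lastIdx hd) (lastIdx hd))
  have h := hq' t t' (ht.trans ht'.symm) hs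
  simp only [Function.comp_apply] at h
  rw [hu (planeRot hd t) u (by rw [cornerEntry_planeRot, ht, cornerEntry]),
    hu (planeRot hd t') u (by rw [cornerEntry_planeRot, ht', cornerEntry]), ht] at h
  rw [Polynomial.eval_mul, Polynomial.eval_C, cornerEntry, ← h]
  ring

end biinvariant

/-! ### Haar measure -/

section haar

variable (G : Type) [Group G] [TopologicalSpace G] [IsTopologicalGroup G] [CompactSpace G]
  [MeasurableSpace G] [BorelSpace G]

instance isHaarMeasure_normalizedHaar : (normalizedHaar G).IsHaarMeasure :=
  inferInstanceAs (Measure.haarMeasure ⊤).IsHaarMeasure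

instance isProbabilityMeasure_normalizedHaar : IsProbabilityMeasure (normalizedHaar G) :=
  ⟨Measure.haarMeasure_self (K₀ := (⊤ : TopologicalSpace.PositiveCompacts G))⟩

/-- A right translate of the left Haar probability measure is again one, so uniqueness gives right
invariance. -/
instance isMulRightInvariant_normalizedHaar : (normalizedHaar G).IsMulRightInvariant where
  map_mul_right_eq_self g := by
    have : IsProbabilityMeasure ((normalizedHaar G).map (· * g)) :=
      Measure.isProbabilityMeasure_map (measurable_mul_const g).aemeasurable
    exact Measure.isHaarMeasure_eq_of_isProbabilityMeasure _ _

end haar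

theorem continuous_entry (d : ℕ) (ij : Fin d × Fin d) : Continuous (entry d ij) :=
  Complex.continuous_ofReal.comp
    ((continuous_apply_apply ij.1 ij.2).comp continuous_subtype_val)

section reproducing

variable {d : ℕ}

theorem continuous_cornerEntry (hd : 3 ≤ d) : Continuous fun u => (cornerEntry hd u : ℂ) :=
  continuous_entry d (lastIdx hd, lastIdx hd)

theorem continuous_eval_cornerEntry (hd : 3 ≤ d) (p : Polynomial ℂ) :
    Continuous fun u => p.eval (cornerEntry hd u : ℂ) :=
  p.continuous.comp (continuous_cornerEntry hd)

/-- Plane rotations realize every corner entry in `[-1, 1]`, giving infinitely many roots. -/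
theorem eq_zero_of_eval_cornerEntry_eq_zero (hd : 3 ≤ d) {p : Polynomial ℂ}
    (h : ∀ u, p.eval (cornerEntry hd u : ℂ) = 0) : p = 0 := by
  refine Polynomial.eq_zero_of_infinite_isRoot p ?_
  have hinf : (Set.Icc (-1 : ℝ) 1).Infinite := Set.Icc_infinite (by norm_num)
  refine (hinf.image (f := ((↑) : ℝ → ℂ)) Complex.ofReal_injective.injOn).mono ?_
  rintro _ ⟨c, hc, rfl⟩
  obtain ⟨t, -, ht, -⟩ := exists_cosSin (abs_le.2 hc)
  have := h (planeRot hd t)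
  rwa [cornerEntry_planeRot, ht] at this

theorem eval_map_conj (p : Polynomial ℂ) (c : ℝ) :
    (p.map (starRingEnd ℂ)).eval (c : ℂ) = starRingEnd ℂ (p.eval (c : ℂ)) := by
  rw [Polynomial.eval_map, Polynomial.eval, Polynomial.hom_eval₂, Complex.conj_ofReal,
    RingHom.comp_id]

/-- There is a polynomial `p` of degree at most `N` for which integration against `p` reproduces
the value at `1` of the polynomials of degree at most `N` in the lower right entry. -/
theorem exists_reproducing (hd : 3 ≤ d) (N : ℕ) : ∃ p : Polynomial ℂ, p.natDegree ≤ N ∧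
    ∀ q : Polynomial ℂ, q.natDegree ≤ N → ∫ u, q.eval (cornerEntry hd u : ℂ) *
      p.eval (cornerEntry hd u : ℂ) ∂(normalizedHaar (SO d)) = q.eval 1 := by
  have hint : ∀ p q : Polynomial ℂ, Integrable (fun u => q.eval (cornerEntry hd u : ℂ) *
      p.eval (cornerEntry hd u : ℂ)) (normalizedHaar (SO d)) := fun p q =>
    integrable_of_continuous _
      ((continuous_eval_cornerEntry hd q).mul (continuous_eval_cornerEntry hd p))
  let V := Polynomial.degreeLT ℂ (N + 1)
  have hV : ∀ p : Polynomial ℂ, p ∈ V ↔ p.natDegree ≤ N := by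
    intro p
    rw [Polynomial.mem_degreeLT]
    rcases eq_or_ne p 0 with rfl | hp
    · simp
    · rw [Polynomial.degree_eq_natDegree hp, Nat.cast_lt, Nat.lt_succ_iff]
  -- The pairing `∫ q p` is bilinear on a finite-dimensional space; once it is nondegenerate, every
  -- functional, in particular evaluation at `1`, is represented by some `p`.
  let Φ : V →ₗ[ℂ] Module.Dual ℂ V := LinearMap.mk₂ ℂ
    (fun p q => ∫ u, q.1.eval (cornerEntry hd u : ℂ) * p.1.eval (cornerEntry hd u : ℂ)
      ∂(normalizedHaar (SO d)))
    (fun p p' q => by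
      simp only [Submodule.coe_add, Polynomial.eval_add, mul_add]
      exact integral_add (hint _ _) (hint _ _))
    (fun c p q => by
      simp only [Submodule.coe_smul, Polynomial.eval_smul, smul_eq_mul, mul_left_comm _ c]
      exact integral_const_mul _ _)
    (fun p q q' => by
      simp only [Submodule.coe_add, Polynomial.eval_add, add_mul]
      exact integral_add (hint _ _) (hint _ _))
    (fun c p q => by
      simp only [Submodule.coe_smul, Polynomial.eval_smul, smul_eq_mul, mul_assoc]
      exact integral_const_mul _ _)
  have hinj : Function.Injective Φ := by
    rw [injective_iff_map_eq_zero]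
    intro p hp
    -- The corner entry is real, so pairing `p` with its coefficientwise conjugate gives `∫ |p|²`.
    have hconj : p.1.map (starRingEnd ℂ) ∈ V :=
      (hV _).2 (Polynomial.natDegree_map_le.trans ((hV _).1 p.2))
    have h : ∫ u, (p.1.map (starRingEnd ℂ)).eval (cornerEntry hd u : ℂ) *
        p.1.eval (cornerEntry hd u : ℂ) ∂(normalizedHaar (SO d)) = 0 :=
      LinearMap.congr_fun hp ⟨_, hconj⟩
    simp only [eval_map_conj, ← Complex.normSq_eq_conj_mul_self, integral_complex_ofReal,
      Complex.ofReal_eq_zero] at h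
    have hc : Continuous fun u => Complex.normSq (p.1.eval (cornerEntry hd u : ℂ)) :=
      Complex.continuous_normSq.comp (continuous_eval_cornerEntry hd p.1)
    rw [integral_eq_zero_iff_of_nonneg (fun _ => Complex.normSq_nonneg _)
      (hc.integrable_of_hasCompactSupport (HasCompactSupport.of_compactSpace _)),
      hc.ae_eq_iff_eq _ continuous_zero] at h
    refine Subtype.ext (eq_zero_of_eval_cornerEntry_eq_zero hd fun u => ?_)
    exact Complex.normSq_eq_zero.1 (congrFun h u)
  have hsurj : Function.Surjective Φ :=
    (LinearMap.injective_iff_surjective_of_finrank_eq_finrank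
      Subspace.dual_finrank_eq.symm).1 hinj
  obtain ⟨p, hp⟩ := hsurj ((Polynomial.leval (1 : ℂ)).comp V.subtype)
  refine ⟨p.1, (hV _).1 p.2, fun q hq => ?_⟩
  exact LinearMap.congr_fun hp ⟨q, (hV q).2 hq⟩

end reproducing

/-! ### The rotation-invariant measure on the sphere -/

section sphere

open scoped Pointwise

variable {d : ℕ}

theorem rotate_inv_apply (g : SO d) (x : Sph d) (i : Fin d) :
    (rotate g⁻¹ x).1 i = ∑ j, (g : Matrix (Fin d) (Fin d) ℝ) j i * x.1 j := rfl

theorem rotate_mul (g h : SO d) (x : Sph d) : rotate (g * h) x = rotate g (rotate h x) := by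
  apply Subtype.ext
  change WithLp.toLp 2 _ = WithLp.toLp 2 _
  rw [Submonoid.coe_mul, ← Matrix.mulVec_mulVec]
  rfl

theorem rotate_one (x : Sph d) : rotate 1 x = x := by
  apply Subtype.ext
  change WithLp.toLp 2 _ = _
  rw [Submonoid.coe_one, Matrix.one_mulVec]

theorem continuous_rotate : Continuous fun p : SO d × Sph d => rotate p.1 p.2 := by
  refine Continuous.subtype_mk ((PiLp.continuous_toLp 2 _).comp ?_) _
  exact (continuous_subtype_val.comp continuous_fst).matrix_mulVec
    ((PiLp.continuous_ofLp 2 _).comp (continuous_subtype_val.comp continuous_snd))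

/-- The rotation `g` as a linear isometry of the Euclidean space. -/
def rotIsometry (g : SO d) : EuclideanSpace ℝ (Fin d) ≃ₗᵢ[ℝ] EuclideanSpace ℝ (Fin d) :=
  LinearIsometry.toLinearIsometryEquiv
    { Matrix.toEuclideanLin (g : Matrix (Fin d) (Fin d) ℝ) with
      norm_map' := fun v => by
        refine (pow_left_inj₀ (norm_nonneg _) (norm_nonneg _) two_ne_zero).1 ?_
        have h : ∀ v : EuclideanSpace ℝ (Fin d), ‖v‖ ^ 2 = v.ofLp ⬝ᵥ v.ofLp := by
          intro v
          rw [EuclideanSpace.real_norm_sq_eq]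
          simp [dotProduct, sq]
        rw [h, h]
        exact mulVec_dotProduct_self g v.ofLp } rfl

theorem coe_rotate (g : SO d) (x : Sph d) : (rotate g x).1 = rotIsometry g x.1 := rfl

/-- The surface measure of a set is defined through the volume of the cone over it; this
compatibility of cones with rotations transfers invariance from the volume. -/
theorem smul_image_rotate_preimage (g : SO d) (s : Set (Sph d)) (t : Set ℝ) :
    t • ((↑) '' (rotate g ⁻¹' s) : Set (EuclideanSpace ℝ (Fin d))) =
      rotIsometry g ⁻¹' (t • ((↑) '' s)) := by
  ext v
  simp only [Set.mem_smul, Set.mem_image, Set.mem_preimage]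
  constructor
  · rintro ⟨r, hr, _, ⟨x, hx, rfl⟩, rfl⟩
    exact ⟨r, hr, _, ⟨rotate g x, hx, rfl⟩, by rw [map_smul, coe_rotate]⟩
  · rintro ⟨r, hr, _, ⟨x, hx, rfl⟩, h⟩
    refine ⟨r, hr, _, ⟨rotate g⁻¹ x, ?_, rfl⟩, ?_⟩
    · rwa [← rotate_mul, mul_inv_cancel, rotate_one]
    · apply (rotIsometry g).injective
      rw [← h, map_smul, ← coe_rotate, ← rotate_mul, mul_inv_cancel, rotate_one]

theorem measurePreserving_rotate (g : SO d) :
    MeasurePreserving (rotate g) (sphereMeasure d) (sphereMeasure d) := by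
  have hm : Measurable (rotate g) :=
    (continuous_rotate.comp (Continuous.prodMk_right g)).measurable
  have h : MeasurePreserving (rotate g)
      (volume : Measure (EuclideanSpace ℝ (Fin d))).toSphere
      (volume : Measure (EuclideanSpace ℝ (Fin d))).toSphere := by
    refine ⟨hm, Measure.ext fun s hs => ?_⟩
    rw [Measure.map_apply hm hs, Measure.toSphere_apply' _ hs, Measure.toSphere_apply' _ (hm hs),
      smul_image_rotate_preimage,
      (rotIsometry g).measurePreserving.measure_preimage_emb
        (rotIsometry g).toHomeomorph.measurableEmbedding]
  exact h.smul_measure _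

theorem isProbabilityMeasure_sphereMeasure (hd : 3 ≤ d) :
    IsProbabilityMeasure (sphereMeasure d) := by
  have : Nonempty (Fin d) := ⟨lastIdx hd⟩
  have : NeZero (volume : Measure (EuclideanSpace ℝ (Fin d))).toSphere :=
    ⟨Measure.toSphere_ne_zero _⟩
  exact isProbabilityMeasureSMul

/-- The north pole `e^d`. -/
def northPole (hd : 3 ≤ d) : Sph d :=
  ⟨WithLp.toLp 2 (lastVec d), by
    rw [mem_sphere_zero_iff_norm, ← pow_eq_one_iff_of_nonneg (norm_nonneg _) two_ne_zero,
      EuclideanSpace.real_norm_sq_eq, ← lastVec_dotProduct_self hd]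
    simp [dotProduct, sq]⟩

theorem exists_rotate_northPole_eq (hd : 3 ≤ d) (x : Sph d) :
    ∃ g : SO d, rotate g (northPole hd) = x := by
  obtain ⟨g, hg⟩ := exists_mulVec_lastVec_eq hd (b := x.1.ofLp) (by
    have h : ‖x.1‖ ^ 2 = 1 := by simp
    rw [EuclideanSpace.real_norm_sq_eq] at h
    simpa [dotProduct, sq] using h)
  exact ⟨g, Subtype.ext (congrArg (WithLp.toLp 2) hg)⟩

theorem integral_integral_swap_of_compact {X Y : Type*} [TopologicalSpace X] [CompactSpace X]
    [TopologicalSpace Y] [CompactSpace Y] [MeasurableSpace X] [MeasurableSpace Y]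
    [OpensMeasurableSpace X] [OpensMeasurableSpace Y] {f : X → Y → ℂ}
    (hf : Continuous fun p : X × Y => f p.1 p.2) (μ : Measure X) (ν : Measure Y)
    [IsFiniteMeasure μ] [IsFiniteMeasure ν] :
    ∫ x, (∫ y, f x y ∂ν) ∂μ = ∫ y, (∫ x, f x y ∂μ) ∂ν :=
  integral_integral_swap_of_hasCompactSupport hf (HasCompactSupport.of_compactSpace _)

/-- Integration over the sphere as integration over the rotation group. -/
theorem integral_sphere_eq (hd : 3 ≤ d) {φ : Sph d → ℂ} (hφ : Continuous φ) :
    ∫ x, φ x ∂(sphereMeasure d) =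
      ∫ g, φ (rotate g (northPole hd)) ∂(normalizedHaar (SO d)) := by
  have := isProbabilityMeasure_sphereMeasure hd
  have h1 : ∀ g : SO d, ∫ x, φ (rotate g x) ∂(sphereMeasure d) = ∫ x, φ x ∂(sphereMeasure d) := by
    intro g
    have hm := measurePreserving_rotate g
    conv_rhs => rw [← hm.map_eq]
    exact (integral_map hm.measurable.aemeasurable hφ.aestronglyMeasurable).symm
  have h2 : ∀ x : Sph d, ∫ g, φ (rotate g x) ∂(normalizedHaar (SO d)) =
      ∫ g, φ (rotate g (northPole hd)) ∂(normalizedHaar (SO d)) := by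
    intro x
    obtain ⟨u, rfl⟩ := exists_rotate_northPole_eq hd x
    simp only [← rotate_mul]
    exact integral_mul_right_eq_self (fun g => φ (rotate g (northPole hd))) u
  -- The integral of `φ(g x)` over group and sphere has an inner integral that is constant in either
  -- order, by invariance of the respective measure.
  have h3 := integral_integral_swap_of_compact (f := fun (g : SO d) x => φ (rotate g x))
    (hφ.comp continuous_rotate) (normalizedHaar (SO d)) (sphereMeasure d)
  simpa only [h1, h2, integral_const, probReal_univ, one_smul] using h3

end sphere

/-! ### Averages over `SO(d-1)` -/

section average

variable {d : ℕ}

theorem SOsub_apply_last (hd : 3 ≤ d) (h : SOsub d) (i : Fin d) :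
    ((h : SO d) : Matrix (Fin d) (Fin d) ℝ) i (lastIdx hd) =
      (1 : Matrix (Fin d) (Fin d) ℝ) i (lastIdx hd) := by
  have := congrFun h.2 i
  rw [mulVec_lastVec hd] at this
  rw [this, lastVec_eq hd, Matrix.one_apply, Pi.single_apply]

theorem SOsub_last_apply (hd : 3 ≤ d) (h : SOsub d) (j : Fin d) :
    ((h : SO d) : Matrix (Fin d) (Fin d) ℝ) (lastIdx hd) j =
      (1 : Matrix (Fin d) (Fin d) ℝ) (lastIdx hd) j := by
  have h1 : ((h : SO d) : Matrix (Fin d) (Fin d) ℝ) (lastIdx hd) j =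
    (((h⁻¹ : SOsub d) : SO d) : Matrix (Fin d) (Fin d) ℝ) j (lastIdx hd) := rfl
  rw [h1, SOsub_apply_last, Matrix.one_apply, Matrix.one_apply]
  simp only [eq_comm]

theorem cornerEntry_SOsub_mul (hd : 3 ≤ d) (h : SOsub d) (u : SO d) :
    cornerEntry hd (h * u) = cornerEntry hd u := by
  rw [cornerEntry, Submonoid.coe_mul, Matrix.mul_apply]
  simp only [SOsub_last_apply hd h]
  rw [← Matrix.mul_apply, Matrix.one_mul, cornerEntry]

/-- Because `g⁻¹ = gᵀ`, this is the inner product `⟨g e^d, u e^d⟩`: it sees `g` only through the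
point `g e^d`, and linearly. -/
theorem cornerEntry_inv_mul (hd : 3 ≤ d) (g u : SO d) : (cornerEntry hd (g⁻¹ * u) : ℂ) =
    ∑ i, headCoord d d i (rotate g (northPole hd)) * entry d (i, lastIdx hd) u := by
  have h : ∀ i, headCoord d d i (rotate g (northPole hd)) = entry d (i, lastIdx hd) g := by
    intro i
    rw [headCoord, coord, dif_pos (by omega), entry]
    exact congrArg _ (mulVec_lastVec hd _ i)
  simp only [h]
  rw [cornerEntry, Submonoid.coe_mul, Matrix.mul_apply, Complex.ofReal_sum]
  exact Finset.sum_congr rfl fun i _ => Complex.ofReal_mul _ _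

variable {Y : Type*} [TopologicalSpace Y]

theorem comp_mul_right_mem_sepSpan {N : ℕ} {f : SO d → ℂ} (hf : f ∈ polyFun (entry d) N)
    {ψ : Y → SO d} (hψ : Continuous ψ) :
    (fun p : SO d × Y => f (p.1 * ψ p.2)) ∈ sepSpan (polyFun (entry d) N) Y := by
  refine comp_mem_of_mem_polyFun (φ := fun p : SO d × Y => p.1 * ψ p.2)
    (isFiltration_sepSpan (isFiltration_polyFun (entry d))) (fun ij => ?_) hf
  have : entry d ij ∘ (fun p : SO d × Y => p.1 * ψ p.2) =
      ∑ k, fun p : SO d × Y => entry d (ij.1, k) p.1 * entry d (k, ij.2) (ψ p.2) := by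
    ext p
    simp [entry, Matrix.mul_apply, Finset.sum_apply]
  rw [this]
  exact Submodule.sum_mem _ fun k _ =>
    mul_mem_sepSpan (var_mem_polyFun _ _) ((continuous_entry d _).comp hψ)

theorem comp_mul_left_mem_sepSpan {N : ℕ} {f : SO d → ℂ} (hf : f ∈ polyFun (entry d) N)
    {ψ : Y → SO d} (hψ : Continuous ψ) :
    (fun p : SO d × Y => f (ψ p.2 * p.1)) ∈ sepSpan (polyFun (entry d) N) Y := by
  refine comp_mem_of_mem_polyFun (φ := fun p : SO d × Y => ψ p.2 * p.1)
    (isFiltration_sepSpan (isFiltration_polyFun (entry d))) (fun ij => ?_) hf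
  have : entry d ij ∘ (fun p : SO d × Y => ψ p.2 * p.1) =
      ∑ k, fun p : SO d × Y => entry d (k, ij.2) p.1 * entry d (ij.1, k) (ψ p.2) := by
    ext p
    simp [entry, Matrix.mul_apply, Finset.sum_apply, mul_comm]
  rw [this]
  exact Submodule.sum_mem _ fun k _ =>
    mul_mem_sepSpan (var_mem_polyFun _ _) ((continuous_entry d _).comp hψ)

/-- A polynomial on `SO(d)` of degree at most `N` that is invariant under `SO(d-1)` from the right
is a polynomial of degree at most `N` on the sphere. -/
theorem exists_polyFun_sphere_of_invariant (hd : 3 ≤ d) {N : ℕ} {G : SO d → ℂ}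
    (hG : G ∈ polyFun (entry d) N) (hinv : ∀ (h : SOsub d) u, G (u * h) = G u) :
    ∃ φ ∈ polyFun (headCoord d d) N, ∀ g, G g = φ (rotate g (northPole hd)) := by
  obtain ⟨p, hp, hrep⟩ := exists_reproducing hd N
  have hGc : Continuous G := continuous_of_mem_polyFun (continuous_entry d) hG
  -- The convolution of `G` with the reproducing kernel, with `⟨x, u e^d⟩` in place of the corner
  -- entry of `g⁻¹ u`.
  refine ⟨fun x => ∫ u, p.eval (∑ i, headCoord d d i x * entry d (i, lastIdx hd) u) * G u
    ∂(normalizedHaar (SO d)), ?_, fun g => ?_⟩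
  · have hw : (fun q : Sph d × SO d => ∑ i, headCoord d d i q.1 * entry d (i, lastIdx hd) q.2) ∈
        sepSpan (polyFun (headCoord d d) 1) (SO d) := by
      have := Submodule.sum_mem (sepSpan (polyFun (headCoord d d) 1) (SO d)) (t := Finset.univ)
        fun i _ => mul_mem_sepSpan (var_mem_polyFun (headCoord d d) i)
          (continuous_entry d (i, lastIdx hd))
      convert this using 1
      ext q
      simp
    exact integral_mem_of_mem_sepSpan (mul_coeff_mem_sepSpan
      ((isFiltration_sepSpan (isFiltration_polyFun (headCoord d d))).eval_mem hw hp) hGc) _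
  -- Averaging makes `B` left-invariant, right invariance is inherited from `G`, and `B 1 = G g`.
  · set B : SO d → ℂ := fun u => ∫ h : SOsub d, G (g * h * u) ∂(normalizedHaar (SOsub d)) with hB
    have hBmem : B ∈ polyFun (entry d) N :=
      integral_mem_of_mem_sepSpan (comp_mul_left_mem_sepSpan hG
        (ψ := fun h : SOsub d => g * h) (by fun_prop)) _
    have hBl : ∀ (h : SOsub d) u, B (h * u) = B u := by
      intro h u
      have := integral_mul_right_eq_self (μ := normalizedHaar (SOsub d))
        (fun k : SOsub d => G (g * k * u)) h
      simpa only [hB, Subgroup.coe_mul, mul_assoc] using this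
    have hBr : ∀ (h : SOsub d) u, B (u * h) = B u := by
      intro h u
      simp only [hB, ← mul_assoc, hinv]
    obtain ⟨q, hq, hBq⟩ := exists_polynomial_cornerEntry hd hBmem hBl hBr
    have h1 : B 1 = G g := by simp [hB, hinv]
    have h2 : q.eval 1 = B 1 := by
      rw [hBq 1, cornerEntry, Submonoid.coe_one, Matrix.one_apply_eq, Complex.ofReal_one]
    have h3 : ∀ h : SOsub d, ∫ u, G (g * h * u) * p.eval (cornerEntry hd u : ℂ)
        ∂(normalizedHaar (SO d)) = ∫ u, G u * p.eval (cornerEntry hd (g⁻¹ * u) : ℂ)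
        ∂(normalizedHaar (SO d)) := by
      intro h
      -- Substituting `u ↦ g h u` turns the kernel into `p(c(h u)) = p(c(u))`, so the integral does
      -- not depend on `h`.
      rw [← integral_mul_left_eq_self (fun u => G u * p.eval (cornerEntry hd (g⁻¹ * u) : ℂ))
        (g * (h : SO d))]
      simp only [mul_assoc, inv_mul_cancel_left, cornerEntry_SOsub_mul]
    have hcont : Continuous fun r : SO d × SOsub d =>
        G (g * r.2 * r.1) * p.eval (cornerEntry hd r.1 : ℂ) :=
      (hGc.comp (by fun_prop)).mul ((continuous_eval_cornerEntry hd p).comp continuous_fst)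
    calc G g = ∫ u, B u * p.eval (cornerEntry hd u : ℂ) ∂(normalizedHaar (SO d)) := by
          simp only [hBq]
          rw [hrep q hq, h2, h1]
      _ = ∫ u, ∫ h : SOsub d, G (g * h * u) * p.eval (cornerEntry hd u : ℂ)
          ∂(normalizedHaar (SOsub d)) ∂(normalizedHaar (SO d)) := by
          simp only [hB, integral_mul_const]
      _ = ∫ u, G u * p.eval (cornerEntry hd (g⁻¹ * u) : ℂ) ∂(normalizedHaar (SO d)) := by
          rw [integral_integral_swap_of_compact hcont]
          simp only [h3, integral_const, probReal_univ, one_smul]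
      _ = _ := by simp only [cornerEntry_inv_mul, mul_comm]

theorem exists_polyFun_sphere_average (hd : 3 ≤ d) {N : ℕ} {F : SO d → ℂ}
    (hF : F ∈ polyFun (entry d) N) : ∃ φ ∈ polyFun (headCoord d d) N,
      ∀ g, ∫ h : SOsub d, F (g * h) ∂(normalizedHaar (SOsub d)) =
        φ (rotate g (northPole hd)) := by
  refine exists_polyFun_sphere_of_invariant hd (integral_mem_of_mem_sepSpan
    (comp_mul_right_mem_sepSpan hF (ψ := fun h : SOsub d => h) continuous_subtype_val) _)
    fun h u => ?_
  have := integral_mul_left_eq_self (μ := normalizedHaar (SOsub d))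
    (fun k : SOsub d => F (u * k)) h
  simpa only [Subgroup.coe_mul, mul_assoc] using this

theorem integral_average {F : SO d → ℂ} (hF : Continuous F) :
    ∫ g, (∫ h : SOsub d, F (g * h) ∂(normalizedHaar (SOsub d))) ∂(normalizedHaar (SO d)) =
      ∫ g, F g ∂(normalizedHaar (SO d)) := by
  rw [integral_integral_swap_of_compact (f := fun (g : SO d) (h : SOsub d) => F (g * h))
    (by fun_prop)]
  simp only [integral_mul_right_eq_self, integral_const, probReal_univ, one_smul]

end average

/-! ### Matrix coefficients as polynomials -/

section matrixCoeff

variable {d : ℕ}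

/-- The entries of the upper left block as functions on `SO(d-1)`. -/
def blockEntry (d : ℕ) (ij : Fin (d - 1) × Fin (d - 1)) (h : SOsub d) : ℂ :=
  entry d (Fin.castLE (Nat.sub_le d 1) ij.1, Fin.castLE (Nat.sub_le d 1) ij.2) h

theorem mem_rotPoly_iff {N : ℕ} {f : SOsub d → ℂ} :
    f ∈ rotPoly d N ↔ f ∈ polyFun (blockEntry d) N :=
  mem_polyFun_iff.symm

/-- An element of `SO(d-1)` has constant last row and column; the other entries belong to the block.
-/
theorem entry_SOsub_mem_polyFun (hd : 3 ≤ d) (i j : Fin d) :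
    (fun h : SOsub d => entry d (i, j) h) ∈ polyFun (blockEntry d) 1 := by
  by_cases hi : i = lastIdx hd
  · simp only [hi, entry, SOsub_last_apply]
    exact const_mem_polyFun _ _ _
  by_cases hj : j = lastIdx hd
  · simp only [hj, entry, SOsub_apply_last]
    exact const_mem_polyFun _ _ _
  simp only [lastIdx, Fin.ext_iff] at hi hj
  exact var_mem_polyFun (blockEntry d) (⟨i, by omega⟩, ⟨j, by omega⟩)

theorem continuous_headCoord (m : ℕ) (i : Fin m) : Continuous (headCoord d m i) := by
  refine Complex.continuous_ofReal.comp (?_ : Continuous fun x : Sph d => coord x (i + 1))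
  simp only [coord, add_tsub_cancel_right]
  split_ifs with h
  · fun_prop
  · exact continuous_const

theorem coord_rotate_inv (g : SO d) (x : Sph d) (i : Fin d) :
    (coord (rotate g⁻¹ x) (i + 1) : ℂ) = ∑ j, entry d (j, i) g * headCoord d d j x := by
  simp only [coord, headCoord, entry, add_tsub_cancel_right, Fin.is_lt, dif_pos, Fin.eta,
    rotate_inv_apply]
  push_cast
  rfl

theorem continuous_sphHarmonic {n : ℕ} (hd : 3 ≤ d) {k : Fin (d - 2) → ℤ}
    (hk : k ∈ indexSet d n) : Continuous (sphHarmonic d n k) :=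
  continuous_of_mem_polyFun (continuous_headCoord d) (sphHarmonic_mem_polyFun hd hk)

/-- The inverse is the transpose, so the coordinates of `g⁻¹ x` are linear in the entries of `g`,
and the degree of the harmonic carries over. -/
theorem matrixCoeff_mem_polyFun {n : ℕ} (hd : 3 ≤ d) {k m : Fin (d - 2) → ℤ}
    (hk : k ∈ indexSet d n) (hm : m ∈ indexSet d n) :
    matrixCoeff d n k m ∈ polyFun (entry d) n := by
  have := isProbabilityMeasure_sphereMeasure hd
  refine integral_mem_of_mem_sepSpan (f := fun p : SO d × Sph d =>
    sphHarmonic d n m (rotate p.1⁻¹ p.2) * starRingEnd ℂ (sphHarmonic d n k p.2))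
    (mul_coeff_mem_sepSpan ?_ (Complex.continuous_conj.comp (continuous_sphHarmonic hd hk))) _
  refine comp_mem_of_mem_polyFun (φ := fun p : SO d × Sph d => rotate p.1⁻¹ p.2)
    (isFiltration_sepSpan (isFiltration_polyFun (entry d))) (fun i => ?_)
    (sphHarmonic_mem_polyFun hd hm)
  have : headCoord d d i ∘ (fun p : SO d × Sph d => rotate p.1⁻¹ p.2) =
      ∑ j, fun p : SO d × Sph d => entry d (j, i) p.1 * headCoord d d j p.2 := by
    ext p
    simp [headCoord, coord_rotate_inv]
  rw [this]
  exact Submodule.sum_mem _ fun j _ =>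
    mul_mem_sepSpan (var_mem_polyFun _ _) (continuous_headCoord _ _)

/-- Sharper than the bound `n`: with `(g h)⁻¹ x = h⁻¹ (g⁻¹ x)`, only the coordinates other than
`x_d` depend on `h`, and the harmonic has degree `|m_1|` in those. -/
theorem matrixCoeff_mul_mem_polyFun {n : ℕ} (hd : 3 ≤ d) {k m : Fin (d - 2) → ℤ}
    (hk : k ∈ indexSet d n) (hm : m ∈ indexSet d n) (g : SO d) :
    (fun h : SOsub d => matrixCoeff d n k m (g * h)) ∈
      polyFun (blockEntry d) (extIndex n m 1).natAbs := by
  have := isProbabilityMeasure_sphereMeasure hd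
  obtain ⟨a, ha, q, hq, haq⟩ := exists_sphHarmonic_eq_mul hd hm
  refine integral_mem_of_mem_sepSpan (f := fun p : SOsub d × Sph d =>
    sphHarmonic d n m (rotate (g * (p.1 : SO d))⁻¹ p.2) * starRingEnd ℂ (sphHarmonic d n k p.2))
    (mul_coeff_mem_sepSpan ?_ (Complex.continuous_conj.comp (continuous_sphHarmonic hd hk))) _
  have hS := isFiltration_sepSpan (Y := Sph d) (isFiltration_polyFun (blockEntry d))
  have hg : Continuous fun x : Sph d => rotate g⁻¹ x :=
    continuous_rotate.comp (Continuous.prodMk_right g⁻¹)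
  have hcoord : ∀ i : Fin d, (fun p : SOsub d × Sph d =>
      (coord (rotate (g * (p.1 : SO d))⁻¹ p.2) (i + 1) : ℂ)) =
      ∑ j, fun p : SOsub d × Sph d => entry d (j, i) p.1 * headCoord d d j (rotate g⁻¹ p.2) := by
    intro i
    ext p
    rw [mul_inv_rev, rotate_mul, coord_rotate_inv, Finset.sum_apply]
  have ha' : (fun p : SOsub d × Sph d => a (rotate (g * (p.1 : SO d))⁻¹ p.2)) ∈
      sepSpan (polyFun (blockEntry d) 0) (Sph d) := by
    -- The last coordinate of `h⁻¹ (g⁻¹ x)` is that of `g⁻¹ x`, hence of degree zero in `h`; the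
    -- constant filtration keeps the whole factor there.
    refine comp_mem_of_mem_polyFun
      (φ := fun p : SOsub d × Sph d => rotate (g * (p.1 : SO d))⁻¹ p.2) hS.const (fun _ => ?_) ha
    have hdl : d = (lastIdx hd : ℕ) + 1 := by simp only [lastIdx]; omega
    have := hcoord (lastIdx hd)
    rw [← hdl] at this
    simp only [Function.comp_def, this, entry, SOsub_apply_last]
    exact Submodule.sum_mem _ fun j _ =>
      mul_mem_sepSpan (const_mem_polyFun _ _ _) ((continuous_headCoord _ _).comp hg)
  have hq' : (fun p : SOsub d × Sph d => q (rotate (g * (p.1 : SO d))⁻¹ p.2)) ∈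
      sepSpan (polyFun (blockEntry d) (extIndex n m 1).natAbs) (Sph d) := by
    refine comp_mem_of_mem_polyFun
      (φ := fun p : SOsub d × Sph d => rotate (g * (p.1 : SO d))⁻¹ p.2) hS (fun i => ?_) hq
    have := hcoord (Fin.castLE (Nat.sub_le d 1) i)
    simp only [Fin.val_castLE] at this
    simp only [Function.comp_def, headCoord, this]
    exact Submodule.sum_mem _ fun j _ =>
      mul_mem_sepSpan (entry_SOsub_mem_polyFun hd _ _) ((continuous_headCoord _ _).comp hg)
  have := hS.mul ha' hq'
  rw [zero_add] at this
  rw [haq]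
  exact this

theorem indexSet_mono {n n' : ℕ} (h : n ≤ n') : indexSet d n ⊆ indexSet d n' := by
  intro k hk
  refine ⟨fun j hj hj' => ?_, fun j hj => ?_⟩
  · have := hk.1 j hj hj'
    cases j with
    | zero => omega
    | succ j => exact this
  · have := hk.2 j hj
    cases j with
    | zero => exact this.trans (by simpa [extIndex] using h)
    | succ j => exact this

theorem classOne_le_polyFun (hd : 3 ≤ d) (N M : ℕ) : classOne d N M ≤ polyFun (entry d) N := by
  rw [classOne, Submodule.span_le]
  rintro _ ⟨n, hn, k, hk, m, hm, rfl⟩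
  exact (isFiltration_polyFun _).mono hn
    (matrixCoeff_mem_polyFun hd hk (indexSet_mono (min_le_left _ _) hm))

theorem mul_mem_polyFun_of_mem_classOne (hd : 3 ≤ d) {N M : ℕ} {f : SO d → ℂ}
    (hf : f ∈ classOne d N M) (g : SO d) :
    (fun h : SOsub d => f (g * h)) ∈ polyFun (blockEntry d) (min M N) := by
  suffices h : classOne d N M ≤ (polyFun (blockEntry d) (min M N)).comap
      (LinearMap.funLeft ℂ ℂ fun h : SOsub d => g * (h : SO d)) from h hf
  rw [classOne, Submodule.span_le]
  rintro _ ⟨n, hn, k, hk, m, hm, rfl⟩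
  refine (isFiltration_polyFun _).mono ?_
    (matrixCoeff_mul_mem_polyFun hd hk (indexSet_mono (min_le_left _ _) hm) g)
  have h : |extIndex (min n M) m 1| ≤ (min n M : ℕ) := hm.2 0 (Nat.zero_le _)
  have h' : extIndex (min n M) m 1 = extIndex n m 1 := rfl
  rw [h', Int.abs_eq_natAbs] at h
  omega

end matrixCoeff

end DirectionalFrames

end

/-! ### The product quadrature formula -/

open DirectionalFrames in
theorem lemma6 (d : ℕ) (hd : 3 ≤ d) (K j : ℕ) (hj : 1 ≤ j)
    -- a quadrature rule on the sphere, exact for degree `2^(j+1)`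
    (s : ℕ) (η : Fin s → DirectionalFrames.Sph d) (ω : Fin s → ℝ) (hω : ∀ l, 0 ≤ ω l)
    (hη : ∀ f ∈ DirectionalFrames.sphPoly d (2 ^ (j + 1)),
      ∑ l, (ω l : ℂ) * f (η l) = ∫ x, f x ∂(DirectionalFrames.sphereMeasure d))
    -- a quadrature rule on `SO(d-1)`, exact for degree `2 min(K, 2^j)`
    (r : ℕ) (h : Fin r → DirectionalFrames.SOsub d) (μ : Fin r → ℝ) (hμ : ∀ m, 0 < μ m)
    (hh : ∀ f ∈ DirectionalFrames.rotPoly d (2 * min K (2 ^ j)),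
      ∑ m, (μ m : ℂ) * f (h m) =
        ∫ x, f x ∂(DirectionalFrames.normalizedHaar (DirectionalFrames.SOsub d)))
    -- arbitrary rotations taking `e^d` to the quadrature points of the sphere
    (g : Fin s → DirectionalFrames.SO d)
    (hg : ∀ l, (g l : Matrix (Fin d) (Fin d) ℝ).mulVec (DirectionalFrames.lastVec d) =
      (η l).1.ofLp)
    (f₁ f₂ : DirectionalFrames.SO d → ℂ)
    (hf₁ : f₁ ∈ DirectionalFrames.classOne d (2 ^ j) K)
    (hf₂ : f₂ ∈ DirectionalFrames.classOne d (2 ^ j) K) :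
    ∑ l, ∑ m, (ω l : ℂ) * (μ m : ℂ) * f₁ (g l * (h m : DirectionalFrames.SO d)) *
        f₂ (g l * (h m : DirectionalFrames.SO d)) =
      ∫ x, f₁ x * f₂ x ∂(DirectionalFrames.normalizedHaar (DirectionalFrames.SO d)) := by
  have hF : f₁ * f₂ ∈ polyFun (entry d) (2 ^ (j + 1)) := by
    rw [pow_succ, mul_two]
    exact (isFiltration_polyFun _).mul (classOne_le_polyFun hd _ _ hf₁)
      (classOne_le_polyFun hd _ _ hf₂)
  obtain ⟨φ, hφ, hφF⟩ := exists_polyFun_sphere_average hd hF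
  have hinner : ∀ l, ∑ m, (μ m : ℂ) * (f₁ * f₂) (g l * (h m : SO d)) = φ (η l) := by
    intro l
    -- Each factor has degree at most `min K (2^j)` on the coset, so the rule on `SO(d-1)`
    -- integrates the product exactly.
    have hmem : (fun k : SOsub d => (f₁ * f₂) (g l * k)) ∈ rotPoly d (2 * min K (2 ^ j)) := by
      rw [mem_rotPoly_iff, two_mul]
      exact (isFiltration_polyFun _).mul (mul_mem_polyFun_of_mem_classOne hd hf₁ (g l))
        (mul_mem_polyFun_of_mem_classOne hd hf₂ (g l))
    have hl : rotate (g l) (northPole hd) = η l := Subtype.ext (congrArg (WithLp.toLp 2) (hg l))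
    rw [hh _ hmem, hφF, hl]
  calc ∑ l, ∑ m, (ω l : ℂ) * (μ m : ℂ) * f₁ (g l * (h m : SO d)) * f₂ (g l * (h m : SO d))
      = ∑ l, (ω l : ℂ) * φ (η l) := by
        refine Finset.sum_congr rfl fun l _ => ?_
        rw [← hinner l, Finset.mul_sum]
        exact Finset.sum_congr rfl fun m _ => by rw [Pi.mul_apply]; ring
    _ = ∫ x, φ (rotate x (northPole hd)) ∂(normalizedHaar (SO d)) := by
        -- Completeness of the harmonics places `φ` in the space on which the spherical rule is
        -- exact.
        rw [hη φ (polyFun_headCoord_le_sphPoly hd _ hφ),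
          integral_sphere_eq hd (continuous_of_mem_polyFun (continuous_headCoord d) hφ)]
    _ = ∫ x, (f₁ * f₂) x ∂(normalizedHaar (SO d)) := by
        simp only [← hφF]
        exact integral_average (continuous_of_mem_polyFun (continuous_entry d) hF)
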